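/- Let $n \ge 2$. The fan graph $F_n$ has the $n$ vertices $v_2, v_3, \dots, v_n, v_\infty$; its edges are $v_iv_\infty$ for $2 \le i \le n$ and $v_iv_{i+1}$ for $2 \le i < n$. Vertices are ordered by their labels, $2 < 3 < \cdots < n < \infty$. Let $\mathcal{T}_n$ be the set of spanning trees of $F_n$, each identified with its set of edges, and let $P_n \in \mathcal{T}_n$ be the path $v_\infty, v_2, v_3, \dots, v_n$. An edge pivot of $T$ around a vertex $u$ (the pivot) replaces an edge $ux \in T$ by an edge $uy \notin T$, giving $T - ux + uy$. A pivot Gray code listing of $\mathcal{T}_n$ is a list in which every element of $\mathcal{T}_n$ occurs exactly once, nothing else occurs, and each tree after the first is obtained from its predecessor by an edge pivot. Greedy listing. For $T \in \mathcal{T}_n$, $\textsc{Greedy}(T)$ is the list that starts with $T$ and is continued as follows. With current tree $T'$, consider the edge pivots $T' - ux + uy$ in lexicographically increasing order of the labels of $(u, x, y)$, where $u$ may be any vertex of $F_n$, including $v_\infty$. The first one that yields a spanning tree of $F_n$ not yet in the list is performed, and its result is appended and becomes the current tree. If there is no such pivot, the procedure halts. Recursive listing. $\textsc{Gen}(k,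 s_1, e)$ and $\textsc{RevGen}(k, s_1, e)$, with $k \ge 2$ and $s_1, e \in \{0, 1\}$, act on a global variable $T$. Below, "$[-ab+ac]$" means: $T \leftarrow T - ab + ac$, then print $T$. Write $x_k = v_{k+1}$ if $e = 1$, and $x_k = v_\infty$ if $e = 0$. $\textsc{Gen}(k, s_1, e)$: - $k = 2$: if $e = 1$, do $[-v_2v_\infty + v_2v_3]$. - $k = 3$: if $s_1 = 1$, do $[-v_3v_2 + v_3x_3]$. Then do $[-v_2v_\infty + v_2v_3]$. - $k \ge 4$: if $s_1 = 1$, do $\textsc{Gen}(k-1,1,0)$ and then $[-v_kv_{k-1} + v_kx_k]$. Then do, in this order, $\textsc{RevGen}(k-1,1,0)$; $[-v_{k-1}v_{k-2} + v_{k-1}v_k]$; $\textsc{Gen}(k-2,1,1)$; if $k > 4$, $[-v_{k-2}v_{k-1} + v_{k-2}v_\infty]$; $\textsc{RevGen}(k-2,0,0)$. $\textsc{RevGen}(k, s_1, e)$: - $k = 2$: if $e = 1$, do $[-v_2v_3 + v_2v_\infty]$. - $k = 3$: do $[-v_2v_3 + v_2v_\infty]$. Then, if $s_1 = 1$, do $[-v_3x_3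 + v_3v_2]$. - $k \ge 4$: do, in this order, $\textsc{Gen}(k-2,0,0)$; if $k > 4$, $[-v_{k-2}v_\infty + v_{k-2}v_{k-1}]$; $\textsc{RevGen}(k-2,1,1)$; $[-v_{k-1}v_k + v_{k-1}v_{k-2}]$; $\textsc{Gen}(k-1,1,0)$. Then, if $s_1 = 1$, do $[-v_kx_k + v_kv_{k-1}]$ and then $\textsc{RevGen}(k-1,1,0)$. Let $\mathrm{LIST}_n$ be the list of printed trees when $T$ is initialized to $P_n$, $T$ is printed, and $\textsc{Gen}(n,1,0)$ is called. Theorem. For every $n \ge 2$, $\mathrm{LIST}_n = \textsc{Greedy}(P_n)$, and this list is a pivot Gray code listing of $\mathcal{T}_n$. -/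

import Mathlib

namespace FanTrees

/-- Vertex labels: the natural number `i` is the label of `v_i`, and `⊤` is the label `∞` of
`v_∞`, which is larger than every other label. -/
abbrev Label := WithTop ℕ

/-- The vertex `v_i`. -/
def v (i : ℕ) : Label := (i : WithTop ℕ)

/-- The vertex `v_∞`. -/
def vInf : Label := ⊤

/-- The vertices `v_2, …, v_n, v_∞` of the fan graph `F_n`, in increasing order of label. -/
def vertexList (n : ℕ) : List Label := (List.range' 2 (n - 1)).map v ++ [vInf]

/-- A graph on the vertices of `F_n` is represented by its finite set of edges. -/
abbrev EdgeSet := Finset (Sym2 Label)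

/-- The edges of the fan graph `F_n`: the spokes `v_i v_∞` for `2 ≤ i ≤ n`, and the path edges
`v_i v_{i+1}` for `2 ≤ i < n`. -/
def fanEdges (n : ℕ) : EdgeSet :=
  (Finset.Icc 2 n).image (fun i => s(v i, vInf)) ∪
    (Finset.Ico 2 n).image (fun i => s(v i, v (i + 1)))

/-- The simple graph with the vertices of `F_n` and the edge set `E`. -/
def graphOn (n : ℕ) (E : EdgeSet) : SimpleGraph {x : Label // x ∈ vertexList n} :=
  (SimpleGraph.fromEdgeSet (E : Set (Sym2 Label))).induce {x : Label | x ∈ vertexList n}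

/-- `T` is (the edge set of) a spanning tree of `F_n`. -/
def IsSpanningTree (n : ℕ) (T : EdgeSet) : Prop :=
  T ⊆ fanEdges n ∧ (graphOn n T).IsTree

/-- The result `T - uv + uw` of replacing the edge `uv` by the edge `uw`. -/
def move (T : EdgeSet) (u v w : Label) : EdgeSet :=
  insert s(u, w) (T.erase s(u, v))

/-- `T'` arises from `T` by pivoting one edge around a vertex `u`: an edge `uv` of `T` is removed,
and an edge `uw` that is not in `T` is added. -/
def IsPivot (T T' : EdgeSet) : Prop :=
  ∃ u v w : Label, s(u, v) ∈ T ∧ s(u, w) ∉ T ∧ T' = move T u v w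

/-- A pivot Gray code listing of the spanning trees of `F_n`: every spanning tree occurs exactly
once, nothing else occurs, and successive trees differ by one edge pivot. -/
def IsPivotGrayCode (n : ℕ) (L : List EdgeSet) : Prop :=
  L.Nodup ∧ (∀ T : EdgeSet, T ∈ L ↔ IsSpanningTree n T) ∧ L.IsChain IsPivot

/-- The path `v_∞, v_2, v_3, …, v_n`. -/
def path (n : ℕ) : EdgeSet :=
  insert s(vInf, v 2) ((Finset.Ico 2 n).image (fun i => s(v i, v (i + 1))))

/-! ### The greedy listing -/

/-- All graphs `T - ux + uy` with `ux ∈ T` and `uy ∉ T`, ordered by priority: increasingly in the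
pivot `u`, then in the endpoint `x` of the removed edge, then in the endpoint `y` of the added
edge. -/
def candidates (n : ℕ) (T : EdgeSet) : List EdgeSet :=
  (vertexList n).flatMap fun u =>
    ((vertexList n).filter fun x => s(u, x) ∈ T).flatMap fun x =>
      ((vertexList n).filter fun y => s(u, y) ∉ T).map fun y => move T u x y

open Classical in
/-- The result of the highest-priority edge pivot of `T` that yields a spanning tree which has not
been generated yet, if there is one. -/
noncomputable def nextTree (n : ℕ) (generated : List EdgeSet) (T : EdgeSet) : Option EdgeSet :=
  (candidates n T).find? fun T' => decide (IsSpanningTree n T' ∧ T' ∉ generated)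

theorem nextTree_spec {n : ℕ} {generated : List EdgeSet} {T T' : EdgeSet}
    (h : nextTree n generated T = some T') : IsSpanningTree n T' ∧ T' ∉ generated := by
  have := List.find?_some h
  simpa using this

/-- The greedy procedure, after the trees in `generated` have been generated, with current tree
`T`: the trees that are still to be listed. It halts when no edge pivot gives a new tree. -/
noncomputable def greedyFrom (n : ℕ) (generated : List EdgeSet) (T : EdgeSet) : List EdgeSet :=
  match h : nextTree n generated T with
  | none => []
  | some T' => T' :: greedyFrom n (T' :: generated) T'
termination_by ((fanEdges n).powerset.filter (fun X => X ∉ generated)).card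
decreasing_by
  obtain ⟨⟨hsub, -⟩, hnew⟩ := nextTree_spec h
  apply Finset.card_lt_card
  refine ⟨?_, ?_⟩
  · intro X hX
    simp only [Finset.mem_filter, List.mem_cons, not_or] at hX ⊢
    exact ⟨hX.1, hX.2.2⟩
  · intro hle
    have hmem := hle (Finset.mem_filter.mpr ⟨Finset.mem_powerset.mpr hsub, hnew⟩)
    simp at hmem

/-- The listing `Greedy(T)` on `F_n`, starting with the spanning tree `T`. -/
noncomputable def greedy (n : ℕ) (T : EdgeSet) : List EdgeSet :=
  T :: greedyFrom n [T] T

/-! ### The recursive procedures -/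

/-- The state of the recursive procedures: the global variable `T` and the listing printed so
far. -/
structure State where
  tree : EdgeSet
  printed : List EdgeSet

/-- `T ← T - ux + uy; Print(T)`. -/
def step (u x y : Label) (S : State) : State :=
  ⟨move S.tree u x y, S.printed ++ [move S.tree u x y]⟩

/- The third argument of `gen` and `revGen` is `varEdge`. They are never called with `k = 0` or
`k = 1`. -/
mutual

/-- The procedure `Gen(k, s₁, varEdge)`. -/
def gen : ℕ → Bool → Bool → State → State
  | 0, _, _, S => S
  | 1, _, _, S => S
  | 2, _, varEdge, S => if varEdge then step (v 2) vInf (v 3) S else S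
  | 3, s₁, varEdge, S =>
    let S := if s₁ then step (v 3) (v 2) (if varEdge then v 4 else vInf) S else S
    step (v 2) vInf (v 3) S
  | m + 4, s₁, varEdge, S =>
    let k := m + 4
    let S :=
      if s₁ then
        let S := gen (m + 3) true false S
        step (v k) (v (k - 1)) (if varEdge then v (k + 1) else vInf) S
      else S
    let S := revGen (m + 3) true false S
    let S := step (v (k - 1)) (v (k - 2)) (v k) S
    let S := gen (m + 2) true true S
    let S := if 4 < k then step (v (k - 2)) (v (k - 1)) vInf S else S
    revGen (m + 2) false false S

/-- The procedure `RevGen(k, s₁, varEdge)`. -/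
def revGen : ℕ → Bool → Bool → State → State
  | 0, _, _, S => S
  | 1, _, _, S => S
  | 2, _, varEdge, S => if varEdge then step (v 2) (v 3) vInf S else S
  | 3, s₁, varEdge, S =>
    let S := step (v 2) (v 3) vInf S
    if s₁ then step (v 3) (if varEdge then v 4 else vInf) (v 2) S else S
  | m + 4, s₁, varEdge, S =>
    let k := m + 4
    let S := gen (m + 2) false false S
    let S := if 4 < k then step (v (k - 2)) vInf (v (k - 1)) S else S
    let S := revGen (m + 2) true true S
    let S := step (v (k - 1)) (v k) (v (k - 2)) S
    let S := gen (m + 3) true false S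
    if s₁ then
      let S := step (v k) (if varEdge then v (k + 1) else vInf) (v (k - 1)) S
      revGen (m + 3) true false S
    else S

end

/-- The listing `LIST_n`: initialize `T` to the path `P_n`, print `T`, and call `Gen(n, 1, 0)`. -/
def listing (n : ℕ) : List EdgeSet :=
  (gen n true false ⟨path n, [path n]⟩).printed

end FanTrees

/-! The spanning trees of the fan `F_n` are the accepting runs of a two-state automaton, and the
recursive procedures list, one after the other, classes of runs that the automaton describes.

Encode an edge set by a finite set of numbers so that the edges among `v_2, …, v_k, v_∞` have the
codes up to `2 * k`. Reading the codes in increasing order, `Conn k true X` says that the part of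
`X` up to `v_k` is a spanning tree of `F_k`, and `Conn k false X` that it lacks only a connection of
`v_k` to `v_∞`. The runs that end in `Conn n true` are the spanning trees of `F_n`
(`isSpanningTree_iff`): such a run is connected and has `n - 1` edges, and conversely a connected
graph contains such a run, so that a tree is one. The automaton is deterministic in both
directions: the state at `k` and the later codes determine the final state (`conn_transfer`), and
the final state and the later codes determine the state at `k` (`conn_same`).

Each procedure lists, from its first tree `X` on, all trees that agree with `X` beyond `v_k` and
satisfy one condition on the part up to `v_k`: it is a spanning tree of `F_k` (`AllTrees`), such a
tree with the spoke at `v_k` (`TopTrees`), or in the state `Conn k false` (`OpenTrees`). In the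
first two cases the edge `v_k v_{k+1}` may take the role of the spoke. Each class is a disjoint union of
two smaller ones, joined by a single pivot, and `Lists.join` composes the specifications of the
corresponding calls (`genAll_succ`, `genTop`, `genOpen_succ` and their reversals, combined by
induction in `specs`).

Every pivot is the greedy choice for the following reason. When a pivot around `v_k` is performed,
the class listed just before it consists of all trees with the same state and the same codes beyond
`v_k`. A pivot of higher priority around some `v_i` with `i < k` does not change these codes, so by
`conn_same` it does not change the state: its result is in that class and already listed. Among the
few pivots around `v_k` itself, those of higher priority are not possible, do not give a tree, or
give a tree listed before. The last alternative concerns only the pivot of `v_k` from `v_{k-1}` to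
`v_{k+1}`; whether it has been listed depends on the context of the call, recorded in `GenCtx` and
`RevCtx`. Finally, a sequence of greedy steps that prints all spanning trees is the greedy listing
(`printed_eq_greedyFrom`). -/

namespace FanTrees

/-! ### Edge codes -/

/-- The edge with code `c`: the odd code `2 * i + 1` stands for the path edge `v_i v_{i+1}`, the
even code `2 * i` for the spoke `v_i v_∞`. For `i = 2` the spoke has the code `3` instead of `4`:
it behaves like a path edge from `v_∞`, in the role of a vertex `v_1`, to `v_2`. Codes up to `2` and
the code `4` do not stand for edges of a fan. -/
def edge (c : ℕ) : Sym2 Label :=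
  if c = 3 then s(v 2, vInf)
  else if c = 4 then s(v 1, v 2)
  else if c % 2 = 0 then s(v (c / 2), vInf) else s(v (c / 2), v (c / 2 + 1))

theorem v_inj {i j : ℕ} : v i = v j ↔ i = j := by
  simp [v]

theorem v_ne_vInf (i : ℕ) : v i ≠ vInf := by
  simp [v, vInf]

theorem vInf_ne_v (i : ℕ) : vInf ≠ v i := (v_ne_vInf i).symm

theorem v_lt {i j : ℕ} : v i < v j ↔ i < j := by
  simp [v]

theorem v_lt_vInf (i : ℕ) : v i < vInf := by
  simp [v, vInf]

theorem edge_injective : Function.Injective edge := by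
  intro a b h
  unfold edge at h
  split_ifs at h <;>
    simp only [Sym2.eq_iff, v_inj, v_ne_vInf, vInf_ne_v, and_false, false_and, or_false, or_self,
      and_true] at h <;>
    omega

/-- The edge set that consists of the edges with codes in `X`. -/
def enc (X : Finset ℕ) : EdgeSet := X.map ⟨edge, edge_injective⟩

theorem enc_injective : Function.Injective enc := Finset.map_injective _

theorem edge_mem_enc {c : ℕ} {X : Finset ℕ} : edge c ∈ enc X ↔ c ∈ X :=
  Finset.mem_map' ⟨edge, edge_injective⟩

theorem mem_enc {e : Sym2 Label} {X : Finset ℕ} : e ∈ enc X ↔ ∃ c ∈ X, edge c = e := by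
  simp [enc]

theorem enc_exchange (X : Finset ℕ) (c d : ℕ) :
    enc (insert d (X.erase c)) = insert (edge d) ((enc X).erase (edge c)) := by
  simp [enc, Finset.map_insert, Finset.map_erase]

/-! ### Spanning trees as runs of an automaton -/

/-- `Conn k b X` describes the part of `X` on the vertices `v_2, …, v_k, v_∞`. For `b = true` it is
a spanning tree of `F_k`; for `b = false` it is a spanning forest with two components that separates
`v_k` from `v_∞`. -/
def Conn : ℕ → Bool → Finset ℕ → Prop
  | 0, _, _ => False
  | 1, _, _ => False
  | 2, b, X => (3 ∈ X ↔ b = true) ∧ 4 ∉ X ∧ ∀ c ∈ X, 2 < c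
  | k + 3, true, X =>
    (Conn (k + 2) true X ∧
      ((2 * k + 5 ∈ X ∧ 2 * k + 6 ∉ X) ∨ (2 * k + 5 ∉ X ∧ 2 * k + 6 ∈ X))) ∨
    (Conn (k + 2) false X ∧ 2 * k + 5 ∈ X ∧ 2 * k + 6 ∈ X)
  | k + 3, false, X =>
    (Conn (k + 2) true X ∧ 2 * k + 5 ∉ X ∧ 2 * k + 6 ∉ X) ∨
    (Conn (k + 2) false X ∧ 2 * k + 5 ∈ X ∧ 2 * k + 6 ∉ X)

/-- `Y` and `X` contain the same codes above `m`. The tree `X` that is kept fixed comes first. -/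
def Agree (m : ℕ) (X Y : Finset ℕ) : Prop := ∀ c, m < c → (c ∈ Y ↔ c ∈ X)

theorem Agree.refl (m : ℕ) (X : Finset ℕ) : Agree m X X := fun _ _ => Iff.rfl

theorem Agree.symm {m : ℕ} {X Y : Finset ℕ} (h : Agree m X Y) : Agree m Y X :=
  fun c hc => (h c hc).symm

theorem Agree.trans {m : ℕ} {X Y Z : Finset ℕ} (h : Agree m X Y) (h' : Agree m Y Z) :
    Agree m X Z := fun c hc => (h' c hc).trans (h c hc)

theorem Agree.mono {m l : ℕ} {X Y : Finset ℕ} (h : Agree m X Y) (hml : m ≤ l) : Agree l X Y :=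
  fun c hc => h c (by omega)

theorem Agree.pred {m l : ℕ} {X Y : Finset ℕ} (h : Agree m X Y) (hm : m = l + 1)
    (hl : m ∈ Y ↔ m ∈ X) : Agree l X Y := by
  intro c hc
  rcases Nat.lt_or_ge m c with h1 | h1
  · exact h c h1
  · obtain rfl : c = m := by omega
    exact hl

theorem conn_succ_true {k : ℕ} (hk : 2 ≤ k) {X : Finset ℕ} :
    Conn (k + 1) true X ↔
      (Conn k true X ∧ ((2 * k + 1 ∈ X ∧ 2 * k + 2 ∉ X) ∨ (2 * k + 1 ∉ X ∧ 2 * k + 2 ∈ X))) ∨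
      (Conn k false X ∧ 2 * k + 1 ∈ X ∧ 2 * k + 2 ∈ X) := by
  obtain ⟨k, rfl⟩ := Nat.exists_eq_add_of_le' hk
  rfl

theorem conn_succ_false {k : ℕ} (hk : 2 ≤ k) {X : Finset ℕ} :
    Conn (k + 1) false X ↔
      (Conn k true X ∧ 2 * k + 1 ∉ X ∧ 2 * k + 2 ∉ X) ∨
      (Conn k false X ∧ 2 * k + 1 ∈ X ∧ 2 * k + 2 ∉ X) := by
  obtain ⟨k, rfl⟩ := Nat.exists_eq_add_of_le' hk
  rfl

theorem conn_congr {k : ℕ} (hk : 2 ≤ k) {b : Bool} {X Y : Finset ℕ}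
    (h : ∀ c, c ≤ 2 * k → (c ∈ Y ↔ c ∈ X)) (hX : Conn k b X) : Conn k b Y := by
  induction k, hk using Nat.le_induction generalizing b with
  | base =>
    obtain ⟨h1, h2, h3⟩ := hX
    refine ⟨(h 3 (by norm_num)).trans h1, fun h4 => h2 ((h 4 (by norm_num)).1 h4), fun c hc => ?_⟩
    by_contra hlt
    exact hlt (h3 c ((h c (by omega)).1 hc))
  | succ k hk ih =>
    have ih' := fun b => @ih b (fun c hc => h c (by omega))
    have h1 := h (2 * k + 1) (by omega)
    have h2 := h (2 * k + 2) (by omega)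
    have h3 := ih' true
    have h4 := ih' false
    cases b
    · rw [conn_succ_false hk] at hX ⊢
      tauto
    · rw [conn_succ_true hk] at hX ⊢
      tauto

theorem conn_state_unique {k : ℕ} (hk : 2 ≤ k) {b d : Bool} {X : Finset ℕ} (h1 : Conn k b X)
    (h2 : Conn k d X) : b = d := by
  induction k, hk using Nat.le_induction generalizing b d with
  | base =>
    have := h1.1
    have := h2.1
    cases b <;> cases d <;> simp_all
  | succ k hk ih =>
    have h3 := @ih true false
    cases b <;> cases d <;> simp only [conn_succ_false hk, conn_succ_true hk] at h1 h2 <;> grind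

/-- The continuation of a run depends only on the state reached and on the later codes. -/
theorem conn_transfer {k m : ℕ} (hk : 2 ≤ k) (hkm : k ≤ m) {b d : Bool} {X Y : Finset ℕ}
    (hX : Conn k b X) (hY : Conn k b Y) (h : Agree (2 * k) X Y) (hm : Conn m d X) :
    Conn m d Y := by
  induction m, hkm using Nat.le_induction generalizing d with
  | base =>
    rwa [conn_state_unique hk hm hX]
  | succ m hkm ih =>
    have h1 := h (2 * m + 1) (by omega)
    have h2 := h (2 * m + 2) (by omega)
    have h3 := @ih true
    have h4 := @ih false
    cases d
    · rw [conn_succ_false (hk.trans hkm)] at hm ⊢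
      tauto
    · rw [conn_succ_true (hk.trans hkm)] at hm ⊢
      tauto

/-- Runs are deterministic backwards: the final state and the codes above `2 * k` determine the
state at `k`. -/
theorem conn_same {k m : ℕ} (hk : 2 ≤ k) (hkm : k ≤ m) {d : Bool} {X Y : Finset ℕ}
    (h : Agree (2 * k) X Y) (hX : Conn m d X) (hY : Conn m d Y) :
    ∃ b, Conn k b X ∧ Conn k b Y := by
  induction m, hkm using Nat.le_induction generalizing d with
  | base => exact ⟨d, hX, hY⟩
  | succ m hkm ih =>
    have h1 := h (2 * m + 1) (by omega)
    have h2 := h (2 * m + 2) (by omega)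
    have h3 := @ih true
    have h4 := @ih false
    cases d
    · rw [conn_succ_false (hk.trans hkm)] at hX hY
      tauto
    · rw [conn_succ_true (hk.trans hkm)] at hX hY
      tauto

/-- `X` is the set of codes of a spanning tree of `F_n`. -/
def Valid (n : ℕ) (X : Finset ℕ) : Prop := Conn n true X ∧ ∀ c ∈ X, c ≤ 2 * n

theorem Valid.transfer {n k : ℕ} (hk : 2 ≤ k) (hkn : k ≤ n) {b : Bool} {X Y : Finset ℕ}
    (hV : Valid n X) (hX : Conn k b X) (hY : Conn k b Y) (h : Agree (2 * k) X Y) : Valid n Y := by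
  refine ⟨conn_transfer hk hkn hX hY h hV.1, fun c hc => ?_⟩
  by_contra hlt
  exact hlt (hV.2 c ((h c (by omega)).1 hc))

theorem Valid.same {n k : ℕ} (hk : 2 ≤ k) (hkn : k ≤ n) {b : Bool} {X Y : Finset ℕ}
    (hX : Valid n X) (hY : Valid n Y) (h : Agree (2 * k) X Y) (hb : Conn k b X) : Conn k b Y := by
  obtain ⟨d, h1, h2⟩ := conn_same hk hkn h hX.1 hY.1
  rwa [conn_state_unique hk hb h1]

theorem Valid.code {n : ℕ} (hn : 2 ≤ n) {X : Finset ℕ} (hV : Valid n X) {c : ℕ} (hc : c ∈ X) :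
    2 < c ∧ c ≠ 4 ∧ c ≤ 2 * n := by
  obtain ⟨b, h, -⟩ := conn_same le_rfl hn (Agree.refl _ X) hV.1 hV.1
  exact ⟨h.2.2 c hc, fun h4 => h.2.1 (h4 ▸ hc), hV.2 c hc⟩

/-! ### Edges at a vertex -/

theorem v_mem_vertexList {n i : ℕ} (hn : 2 ≤ n) : v i ∈ vertexList n ↔ 2 ≤ i ∧ i ≤ n := by
  simp only [vertexList, List.mem_append, List.mem_map, List.mem_range'_1, v_inj,
    List.mem_singleton, v_ne_vInf, or_false, exists_eq_right]
  omega

theorem vInf_mem_vertexList (n : ℕ) : vInf ∈ vertexList n := by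
  simp [vertexList]

/-- The code `c` is that of an edge at the vertex `v k`. -/
def Inc (k c : ℕ) : Prop := c + 1 = 2 * k ∨ c = 2 * k + 1 ∨ (c = 2 * k ∧ 3 ≤ k)

/-- The other end of the edge with code `c` at `v k`. -/
def nb (k c : ℕ) : Label :=
  if c = 3 ∨ c = 2 * k then vInf else if c = 2 * k + 1 then v (k + 1) else v (k - 1)

theorem edge_eq {k c : ℕ} (hk : 2 ≤ k) (h : Inc k c) : edge c = s(v k, nb k c) := by
  rcases h with h | h | ⟨h, h3⟩
  · rcases Nat.eq_or_lt_of_le hk with rfl | hk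
    · obtain rfl : c = 3 := by omega
      simp [edge, nb]
    · have e1 : c / 2 = k - 1 := by omega
      have e2 : k - 1 + 1 = k := by omega
      rw [edge, nb, if_neg (by omega), if_neg (by omega), if_neg (by omega), if_neg (by omega),
        if_neg (by omega), e1, e2, Sym2.eq_swap]
  · have e1 : c / 2 = k := by omega
    rw [edge, nb, if_neg (by omega), if_neg (by omega), if_neg (by omega), if_neg (by omega),
      if_pos (by omega), e1]
  · have e1 : c / 2 = k := by omega
    rw [edge, nb, if_neg (by omega), if_neg (by omega), if_pos (by omega), if_pos (by omega), e1]

theorem inc_of_edge_eq {k c : ℕ} {y : Label} (hc : 2 < c) (hc4 : c ≠ 4)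
    (h : edge c = s(v k, y)) : 2 ≤ k ∧ Inc k c ∧ y = nb k c := by
  have key : 2 ≤ k ∧ Inc k c := by
    unfold edge at h
    unfold Inc
    split_ifs at h <;>
      simp only [Sym2.eq_iff, v_inj, vInf_ne_v, and_false, or_false] at h <;>
      omega
  refine ⟨key.1, key.2, ?_⟩
  rw [edge_eq key.1 key.2] at h
  exact (Sym2.congr_right.1 h).symm

theorem nb_mem_vertexList {n k c : ℕ} (hk : 2 ≤ k) (hkn : k ≤ n) (hc : Inc k c)
    (hcn : c ≤ 2 * n) : nb k c ∈ vertexList n := by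
  unfold Inc at hc
  unfold nb
  split_ifs
  · exact vInf_mem_vertexList n
  all_goals rw [v_mem_vertexList (by omega)]; omega

/-! ### Spanning trees of the fan -/

/-- The codes of the edges of `F_n`. -/
def codes (n : ℕ) : Finset ℕ := (Finset.Icc 3 (2 * n)).erase 4

theorem mem_codes {n c : ℕ} : c ∈ codes n ↔ 2 < c ∧ c ≠ 4 ∧ c ≤ 2 * n := by
  simp only [codes, Finset.mem_erase, Finset.mem_Icc]
  omega

theorem fanEdges_eq {n : ℕ} (hn : 2 ≤ n) : fanEdges n = enc (codes n) := by
  ext e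
  simp only [fanEdges, mem_enc, mem_codes, Finset.mem_union, Finset.mem_image, Finset.mem_Icc,
    Finset.mem_Ico]
  constructor
  · rintro (⟨i, hi, rfl⟩ | ⟨i, hi, rfl⟩)
    · rcases Nat.eq_or_lt_of_le hi.1 with rfl | h
      · exact ⟨3, by omega, rfl⟩
      · refine ⟨2 * i, by omega, ?_⟩
        rw [edge_eq hi.1 (Or.inr (Or.inr ⟨rfl, h⟩)), nb, if_pos (by simp)]
    · refine ⟨2 * i + 1, by omega, ?_⟩
      rw [edge_eq hi.1 (Or.inr (Or.inl rfl)), nb, if_neg (by omega), if_pos rfl]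
  · rintro ⟨c, hc, rfl⟩
    unfold edge
    split_ifs with h1 h2 h3
    · exact Or.inl ⟨2, by omega, rfl⟩
    · omega
    · exact Or.inl ⟨c / 2, by omega, rfl⟩
    · exact Or.inr ⟨c / 2, by omega, rfl⟩

theorem subset_fanEdges_iff {n : ℕ} (hn : 2 ≤ n) {T : EdgeSet} :
    T ⊆ fanEdges n ↔ ∃ X, X ⊆ codes n ∧ T = enc X := by
  rw [fanEdges_eq hn]
  constructor
  · intro h
    obtain ⟨X, hX, rfl⟩ := Finset.subset_map_iff.1 h
    exact ⟨X, hX, rfl⟩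
  · rintro ⟨X, hX, rfl⟩
    exact Finset.map_subset_map.2 hX

theorem nodup_vertexList (n : ℕ) : (vertexList n).Nodup := by
  rw [vertexList, List.nodup_append]
  refine ⟨List.Nodup.map (fun i j h => v_inj.1 h) List.nodup_range', by simp, ?_⟩
  intro a ha b hb
  simp only [List.mem_map, List.mem_singleton] at ha hb
  obtain ⟨i, -, rfl⟩ := ha
  rw [hb]
  exact v_ne_vInf i

theorem card_vertices {n : ℕ} (hn : 2 ≤ n) : Nat.card {x : Label // x ∈ vertexList n} = n := by
  have h : Nat.card {x : Label // x ∈ (vertexList n).toFinset} = n := by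
    rw [Nat.card_eq_fintype_card, Fintype.card_coe, List.toFinset_card_of_nodup
      (nodup_vertexList n)]
    simp only [vertexList, List.length_append, List.length_map, List.length_range',
      List.length_singleton]
    omega
  simpa only [List.mem_toFinset] using h

theorem graphOn_adj {n : ℕ} {T : EdgeSet} {x y : {x : Label // x ∈ vertexList n}} :
    (graphOn n T).Adj x y ↔ s(x.1, y.1) ∈ T ∧ x.1 ≠ y.1 := by
  simp [graphOn, SimpleGraph.fromEdgeSet_adj]

theorem edge_ends {n c : ℕ} (hn : 2 ≤ n) (hc : c ∈ codes n) :
    ∃ x ∈ vertexList n, ∃ y ∈ vertexList n, x ≠ y ∧ edge c = s(x, y) := by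
  rw [mem_codes] at hc
  unfold edge
  split_ifs with h1 h2 h3
  · exact ⟨v 2, by rw [v_mem_vertexList hn]; omega, vInf, vInf_mem_vertexList n, v_ne_vInf _, rfl⟩
  · omega
  · exact ⟨_, by rw [v_mem_vertexList hn]; omega, vInf, vInf_mem_vertexList n, v_ne_vInf _, rfl⟩
  · exact ⟨_, by rw [v_mem_vertexList hn]; omega, _, by rw [v_mem_vertexList hn]; omega,
      fun h => by rw [v_inj] at h; omega, rfl⟩

theorem card_edges {n : ℕ} (hn : 2 ≤ n) {X : Finset ℕ} (hX : X ⊆ codes n) :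
    Nat.card (graphOn n (enc X)).edgeSet = X.card := by
  have h : (Sym2.map Subtype.val) '' (graphOn n (enc X)).edgeSet = (enc X : Set (Sym2 Label)) := by
    ext e
    constructor
    · rintro ⟨e, he, rfl⟩
      induction e with
      | _ x y => exact (graphOn_adj.1 he).1
    · intro he
      obtain ⟨c, hc, rfl⟩ := mem_enc.1 (Finset.mem_coe.1 he)
      obtain ⟨x, hx, y, hy, hxy, hce⟩ := edge_ends hn (hX hc)
      refine ⟨s(⟨x, hx⟩, ⟨y, hy⟩), graphOn_adj.2 ⟨?_, hxy⟩, hce.symm⟩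
      rw [← hce]
      exact he
  rw [Nat.card_coe_set_eq, ← Set.ncard_image_of_injective _
    (Sym2.map.injective Subtype.val_injective), h, Set.ncard_coe_finset, enc, Finset.card_map]

/-- In the graph with edge codes `X`, there is a walk from `a` to `b`. -/
def Joined (n : ℕ) (X : Finset ℕ) (a b : Label) : Prop :=
  ∃ (ha : a ∈ vertexList n) (hb : b ∈ vertexList n), (graphOn n (enc X)).Reachable ⟨a, ha⟩ ⟨b, hb⟩

theorem Joined.trans {n : ℕ} {X : Finset ℕ} {a b c : Label} (h : Joined n X a b)
    (h' : Joined n X b c) : Joined n X a c := by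
  obtain ⟨ha, hb, h⟩ := h
  obtain ⟨hb', hc, h'⟩ := h'
  exact ⟨ha, hc, h.trans h'⟩

theorem Joined.edge {n k c : ℕ} {X : Finset ℕ} (hk : 2 ≤ k) (hkn : k ≤ n) (h : Inc k c)
    (hX : X ⊆ codes n) (hc : c ∈ X) : Joined n X (v k) (nb k c) := by
  have h1 := nb_mem_vertexList hk hkn h (mem_codes.1 (hX hc)).2.2
  refine ⟨(v_mem_vertexList (by omega)).2 ⟨hk, hkn⟩, h1, SimpleGraph.Adj.reachable ?_⟩
  refine graphOn_adj.2 ⟨?_, ?_⟩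
  · change s(v k, nb k c) ∈ _
    rwa [← edge_eq hk h, edge_mem_enc]
  · change v k ≠ nb k c
    unfold nb
    split_ifs
    · exact v_ne_vInf k
    all_goals
      rw [Ne, v_inj]
      omega

/-- Every vertex up to `v k` is joined to `v_∞` or, if the state is `false`, to `v k`. -/
theorem joined_of_conn {n k : ℕ} (hk : 2 ≤ k) (hkn : k ≤ n) {b : Bool} {X : Finset ℕ}
    (hX : X ⊆ codes n) (h : Conn k b X) (i : ℕ) (hi : 2 ≤ i) (hik : i ≤ k) :
    Joined n X (v i) vInf ∨ b = false ∧ Joined n X (v i) (v k) := by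
  have hrefl : ∀ k, 2 ≤ k → k ≤ n → Joined n X (v k) (v k) := fun k h1 h2 =>
    ⟨(v_mem_vertexList (by omega)).2 ⟨h1, h2⟩, _, .refl _⟩
  induction k, hk using Nat.le_induction generalizing b i with
  | base =>
    obtain rfl : i = 2 := le_antisymm hik hi
    cases b
    · exact Or.inr ⟨rfl, hrefl 2 le_rfl hkn⟩
    · exact Or.inl (Joined.edge (k := 2) (c := 3) le_rfl hkn (Or.inl rfl) hX (h.1.2 rfl))
  | succ k hk ih =>
    have hright : 2 * k + 1 ∈ X → Joined n X (v k) (v (k + 1)) := fun hc => by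
      have := Joined.edge hk (by omega) (Or.inr (Or.inl rfl)) hX hc
      rwa [nb, if_neg (by omega), if_pos rfl] at this
    have hleft : 2 * k + 1 ∈ X → Joined n X (v (k + 1)) (v k) := fun hc => by
      obtain ⟨h1, h2, h3⟩ := hright hc
      exact ⟨h2, h1, h3.symm⟩
    have hspoke : 2 * k + 2 ∈ X → Joined n X (v (k + 1)) vInf := fun hc => by
      have := Joined.edge (k := k + 1) (c := 2 * k + 2) (by omega) hkn
        (Or.inr (Or.inr ⟨rfl, by omega⟩)) hX hc
      rwa [nb, if_pos (by omega)] at this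
    have htrue : Conn k true X → ∀ i, 2 ≤ i → i ≤ k → Joined n X (v i) vInf := fun hc i h1 h2 => by
      simpa using ih (by omega) hc i h1 h2
    have hfalse : Conn k false X → ∀ i, 2 ≤ i → i ≤ k →
        Joined n X (v i) vInf ∨ Joined n X (v i) (v k) := fun hc i h1 h2 => by
      simpa using ih (by omega) hc i h1 h2
    rcases Nat.lt_or_ge k i with hlt | hle
    · obtain rfl : i = k + 1 := by omega
      cases b
      · exact Or.inr ⟨rfl, hrefl _ (by omega) hkn⟩
      · left
        rcases (conn_succ_true hk).1 h with ⟨h1, ⟨h2, -⟩ | ⟨-, h2⟩⟩ | ⟨-, -, h2⟩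
        · exact (hleft h2).trans (htrue h1 k hk le_rfl)
        · exact hspoke h2
        · exact hspoke h2
    · cases b
      · rcases (conn_succ_false hk).1 h with ⟨h1, -⟩ | ⟨h1, h2, -⟩
        · exact Or.inl (htrue h1 i hi hle)
        · exact (hfalse h1 i hi hle).imp id fun h => ⟨rfl, h.trans (hright h2)⟩
      · left
        rcases (conn_succ_true hk).1 h with ⟨h1, -⟩ | ⟨h1, h2, h3⟩
        · exact htrue h1 i hi hle
        · exact (hfalse h1 i hi hle).elim id fun h => (h.trans (hright h2)).trans (hspoke h3)

theorem card_filter_succ (X : Finset ℕ) (m : ℕ) :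
    (X.filter (· ≤ m + 1)).card = (X.filter (· ≤ m)).card + if m + 1 ∈ X then 1 else 0 := by
  split_ifs with h
  · rw [← Finset.card_insert_of_notMem (a := m + 1) (by simp)]
    congr 1
    ext c
    simp only [Finset.mem_filter, Finset.mem_insert]
    constructor
    · rintro ⟨h1, h2⟩
      by_cases h3 : c = m + 1
      · exact Or.inl h3
      · exact Or.inr ⟨h1, by omega⟩
    · rintro (rfl | ⟨h1, h2⟩)
      · exact ⟨h, le_rfl⟩
      · exact ⟨h1, by omega⟩
  · rw [add_zero]
    congr 1
    refine Finset.filter_congr fun c hc => ⟨fun h2 => ?_, fun h2 => by omega⟩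
    have : c ≠ m + 1 := fun h3 => h (h3 ▸ hc)
    omega

/-- The number of edges on `v_2, …, v_k, v_∞` in each state. -/
theorem conn_card {k : ℕ} (hk : 2 ≤ k) {b : Bool} {X : Finset ℕ} (h : Conn k b X) :
    (X.filter (· ≤ 2 * k)).card + (if b then 1 else 2) = k := by
  induction k, hk using Nat.le_induction generalizing b with
  | base =>
    have h0 : (X.filter (· ≤ 2)).card = 0 := by
      rw [Finset.card_eq_zero, Finset.filter_eq_empty_iff]
      exact fun c hc => by have := h.2.2 c hc; omega
    have h3 := h.1
    have h4 := h.2.1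
    change (X.filter (· ≤ 3 + 1)).card + _ = 2
    rw [card_filter_succ, card_filter_succ, h0, if_neg h4]
    cases b <;> simp_all
  | succ k hk ih =>
    rw [show 2 * (k + 1) = 2 * k + 1 + 1 from rfl, card_filter_succ, card_filter_succ]
    have h1 := @ih true
    have h2 := @ih false
    cases b
    · rcases (conn_succ_false hk).1 h with ⟨h3, h4, h5⟩ | ⟨h3, h4, h5⟩
      · have := h1 h3
        simp_all
      · have := h2 h3
        simp_all
    · rcases (conn_succ_true hk).1 h with ⟨h3, ⟨h4, h5⟩ | ⟨h4, h5⟩⟩ | ⟨h3, h4, h5⟩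
      · have := h1 h3
        simp_all
      · have := h1 h3
        simp_all
      · have := h2 h3
        simp_all

theorem Valid.card {n : ℕ} (hn : 2 ≤ n) {X : Finset ℕ} (h : Valid n X) : X.card + 1 = n := by
  have := conn_card hn h.1
  rwa [Finset.filter_true_of_mem h.2] at this

theorem Valid.subset_codes {n : ℕ} (hn : 2 ≤ n) {X : Finset ℕ} (h : Valid n X) : X ⊆ codes n :=
  fun _ hc => mem_codes.2 (h.code hn hc)

/-- In a connected graph, a segment `v_j, …, v_k` is joined to the other vertices. -/
theorem not_isolated {n j k : ℕ} (hj : 2 ≤ j) (hjk : j ≤ k) (hkn : k ≤ n) {X : Finset ℕ}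
    (hX : X ⊆ codes n) (hconn : (graphOn n (enc X)).Connected) (hl : 2 * j - 1 ∉ X)
    (hs : ∀ i, j ≤ i → i ≤ k → 2 * i ∉ X) (hr : 2 * k + 1 ∉ X) : False := by
  have hstep : ∀ x y : {x : Label // x ∈ vertexList n}, (graphOn n (enc X)).Adj x y →
      (∃ i, j ≤ i ∧ i ≤ k ∧ x.1 = v i) → ∃ i, j ≤ i ∧ i ≤ k ∧ y.1 = v i := by
    rintro x y hxy ⟨i, hji, hik, hxi⟩
    have hm := (graphOn_adj.1 hxy).1
    rw [hxi] at hm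
    obtain ⟨c, hc, hce⟩ := mem_enc.1 hm
    have hcc := mem_codes.1 (hX hc)
    obtain ⟨-, hi, hy⟩ := inc_of_edge_eq hcc.1 hcc.2.1 hce
    rcases hi with hi | rfl | ⟨rfl, -⟩
    · have hne : i ≠ j := by
        rintro rfl
        exact hl ((show 2 * i - 1 = c by omega) ▸ hc)
      refine ⟨i - 1, by omega, by omega, ?_⟩
      rw [hy, nb, if_neg (by omega), if_neg (by omega)]
    · have hne : i ≠ k := by
        rintro rfl
        exact hr hc
      refine ⟨i + 1, by omega, by omega, ?_⟩
      rw [hy, nb, if_neg (by omega), if_pos rfl]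
    · exact absurd hc (hs i hji hik)
  have hwalk : ∀ x y : {x : Label // x ∈ vertexList n}, (graphOn n (enc X)).Walk x y →
      (∃ i, j ≤ i ∧ i ≤ k ∧ x.1 = v i) → ∃ i, j ≤ i ∧ i ≤ k ∧ y.1 = v i := by
    intro x y p
    induction p with
    | nil => exact id
    | cons h _ ih => exact fun hx => ih (hstep _ _ h hx)
  obtain ⟨p⟩ := hconn.preconnected ⟨v j, (v_mem_vertexList (by omega)).2 ⟨hj, by omega⟩⟩
    ⟨vInf, vInf_mem_vertexList n⟩
  obtain ⟨i, -, -, hi⟩ := hwalk _ _ p ⟨j, le_rfl, hjk, rfl⟩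
  exact vInf_ne_v i hi

/-- A connected spanning subgraph of the fan contains a spanning tree: the automaton, run greedily
on `X`, gets stuck only at a segment that is not joined to the rest. -/
theorem exists_conn_subset {n k : ℕ} (hk : 2 ≤ k) (hkn : k ≤ n) {X : Finset ℕ}
    (hX : X ⊆ codes n) (hconn : (graphOn n (enc X)).Connected) :
    ∃ Y ⊆ X, (∀ c ∈ Y, c ≤ 2 * k) ∧ (Conn k true Y ∨ Conn k false Y ∧
      ∃ j, 2 ≤ j ∧ j ≤ k ∧ 2 * j - 1 ∉ X ∧ ∀ i, j ≤ i → i ≤ k → 2 * i ∉ X) := by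
  have hlow : ∀ c ∈ X, 2 < c ∧ c ≠ 4 := fun c hc =>
    ⟨(mem_codes.1 (hX hc)).1, (mem_codes.1 (hX hc)).2.1⟩
  induction k, hk using Nat.le_induction with
  | base =>
    by_cases h3 : 3 ∈ X
    · refine ⟨{3}, by simpa using h3, by simp, Or.inl ⟨by simp, by simp, by simp⟩⟩
    · refine ⟨∅, by simp, by simp, Or.inr ⟨⟨by simp, by simp, by simp⟩, 2, le_rfl, le_rfl, h3, ?_⟩⟩
      intro i h1 h2 h4
      exact (hlow _ h4).2 (by omega)
  | succ k hk ih =>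
    obtain ⟨Y, hYX, hY, h⟩ := ih (by omega)
    have hb : 2 * k + 1 ∉ Y := fun h => by have := hY _ h; omega
    have ha : 2 * k + 2 ∉ Y := fun h => by have := hY _ h; omega
    have hins : ∀ Z : Finset ℕ, (∀ c ∈ Z, 2 * k < c) → ∀ b, Conn k b Y → Conn k b (Y ∪ Z) := by
      intro Z hZ b
      refine conn_congr hk fun c hc => ?_
      have : c ∉ Z := fun h => by have := hZ c h; omega
      simp [this]
    by_cases hbX : 2 * k + 1 ∈ X
    · rcases h with h | ⟨h, j, hj, hjk, hl, hs⟩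
      · refine ⟨Y ∪ {2 * k + 1}, ?_, ?_, Or.inl ?_⟩
        · exact Finset.union_subset hYX (by simpa using hbX)
        · intro c hc
          rcases Finset.mem_union.1 hc with hc | hc
          · have := hY c hc
            omega
          · rw [Finset.mem_singleton] at hc
            omega
        · rw [conn_succ_true hk]
          exact Or.inl ⟨hins _ (by simp) _ h, Or.inl ⟨by simp, by simp [ha]⟩⟩
      · by_cases haX : 2 * k + 2 ∈ X
        · refine ⟨Y ∪ {2 * k + 1, 2 * k + 2}, ?_, ?_, Or.inl ?_⟩
          · refine Finset.union_subset hYX ?_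
            simp [Finset.insert_subset_iff, hbX, haX]
          · intro c hc
            rcases Finset.mem_union.1 hc with hc | hc
            · have := hY c hc
              omega
            · rw [Finset.mem_insert, Finset.mem_singleton] at hc
              omega
          · rw [conn_succ_true hk]
            exact Or.inr ⟨hins _ (by simp) _ h, by simp, by simp⟩
        · refine ⟨Y ∪ {2 * k + 1}, ?_, ?_, Or.inr ⟨?_, j, hj, by omega, hl, ?_⟩⟩
          · exact Finset.union_subset hYX (by simpa using hbX)
          · intro c hc
            rcases Finset.mem_union.1 hc with hc | hc
            · have := hY c hc
              omega
            · rw [Finset.mem_singleton] at hc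
              omega
          · rw [conn_succ_false hk]
            exact Or.inr ⟨hins _ (by simp) _ h, by simp, by simp [ha]⟩
          · intro i h1 h2
            rcases Nat.lt_or_ge k i with hlt | hle
            · obtain rfl : i = k + 1 := by omega
              exact haX
            · exact hs i h1 hle
    · rcases h with h | ⟨-, j, hj, hjk, hl, hs⟩
      · by_cases haX : 2 * k + 2 ∈ X
        · refine ⟨Y ∪ {2 * k + 2}, ?_, ?_, Or.inl ?_⟩
          · exact Finset.union_subset hYX (by simpa using haX)
          · intro c hc
            rcases Finset.mem_union.1 hc with hc | hc
            · have := hY c hc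
              omega
            · rw [Finset.mem_singleton] at hc
              omega
          · rw [conn_succ_true hk]
            exact Or.inl ⟨hins _ (by simp) _ h, Or.inr ⟨by simp [hb], by simp⟩⟩
        · refine ⟨Y, hYX, fun c hc => by have := hY c hc; omega,
            Or.inr ⟨?_, k + 1, by omega, le_rfl, hbX, ?_⟩⟩
          · rw [conn_succ_false hk]
            exact Or.inl ⟨h, hb, ha⟩
          · intro i h1 h2
            obtain rfl : i = k + 1 := le_antisymm h2 h1
            exact haX
      · exact (not_isolated hj hjk (by omega) hX hconn hl hs hbX).elim

theorem isSpanningTree_iff {n : ℕ} (hn : 2 ≤ n) {T : EdgeSet} :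
    IsSpanningTree n T ↔ ∃ X, T = enc X ∧ Valid n X := by
  have hfin : Finite {x : Label // x ∈ vertexList n} := (vertexList n).finite_toSet
  constructor
  · rintro ⟨hT, htree⟩
    obtain ⟨X, hX, rfl⟩ := (subset_fanEdges_iff hn).1 hT
    rw [SimpleGraph.isTree_iff_connected_and_card, card_edges hn hX, card_vertices hn] at htree
    -- The spanning tree contained in the tree has as many edges, hence is equal to it.
    obtain ⟨Y, hYX, hY, h | ⟨-, j, hj, hjn, hl, hs⟩⟩ := exists_conn_subset hn le_rfl hX htree.1
    · have hV : Valid n Y := ⟨h, hY⟩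
      have := hV.card hn
      rw [Finset.eq_of_subset_of_card_le hYX (by omega)] at hV
      exact ⟨X, rfl, hV⟩
    · refine (not_isolated hj hjn le_rfl hX htree.1 hl hs fun h => ?_).elim
      have := (mem_codes.1 (hX h)).2.2
      omega
  · rintro ⟨X, rfl, hV⟩
    have hX := hV.subset_codes hn
    refine ⟨(subset_fanEdges_iff hn).2 ⟨X, hX, rfl⟩, ?_⟩
    rw [SimpleGraph.isTree_iff_connected_and_card, card_edges hn hX, card_vertices hn]
    refine ⟨?_, hV.card hn⟩
    have hinf : ∀ x, (graphOn n (enc X)).Reachable x ⟨vInf, vInf_mem_vertexList n⟩ := by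
      rintro ⟨x, hx⟩
      induction x using WithTop.recTopCoe with
      | top => exact .refl _
      | coe i =>
        obtain ⟨h1, h2⟩ := (v_mem_vertexList hn).1 hx
        rcases joined_of_conn hn le_rfl hX hV.1 i h1 h2 with ⟨_, _, h⟩ | ⟨h, -⟩
        · exact h
        · exact Bool.noConfusion h
    have : Nonempty {x : Label // x ∈ vertexList n} := ⟨⟨vInf, vInf_mem_vertexList n⟩⟩
    exact ⟨fun x y => (hinf x).trans (hinf y).symm⟩

theorem isSpanningTree_enc {n : ℕ} (hn : 2 ≤ n) {X : Finset ℕ} :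
    IsSpanningTree n (enc X) ↔ Valid n X := by
  rw [isSpanningTree_iff hn]
  constructor
  · rintro ⟨Y, h, hY⟩
    rwa [enc_injective h]
  · exact fun h => ⟨X, rfl, h⟩

/-! ### Greedy steps -/

/-- One step of the greedy procedure: the pivot from `S.tree` to `S'.tree` gives a spanning tree
that is not yet printed, and no pivot of higher priority does. -/
def GreedyStep (n : ℕ) (S S' : State) : Prop :=
  ∃ u ∈ vertexList n, ∃ x ∈ vertexList n, ∃ y ∈ vertexList n,
    s(u, x) ∈ S.tree ∧ s(u, y) ∉ S.tree ∧ S' = step u x y S ∧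
    IsSpanningTree n (move S.tree u x y) ∧ move S.tree u x y ∉ S.printed ∧
    ∀ u' ∈ vertexList n, ∀ x' ∈ vertexList n, ∀ y' ∈ vertexList n,
      (u' < u ∨ u' = u ∧ (x' < x ∨ x' = x ∧ y' < y)) →
      s(u', x') ∈ S.tree → s(u', y') ∉ S.tree →
      IsSpanningTree n (move S.tree u' x' y') → move S.tree u' x' y' ∈ S.printed

/-- The state `S` is described by codes: its tree is `X`, and the printed trees are those in `G`. -/
structure Encodes (S : State) (X : Finset ℕ) (G : Set (Finset ℕ)) : Prop where
  tree : S.tree = enc X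
  printed : ∀ Y, enc Y ∈ S.printed ↔ Y ∈ G

/-- Run from the tree `X` with the set `G` of printed trees, the procedure `f` performs greedy
steps only; it ends with the tree `X'` and the set `G'` of printed trees. -/
def Does (n : ℕ) (f : State → State) (X : Finset ℕ) (G : Set (Finset ℕ)) (X' : Finset ℕ)
    (G' : Set (Finset ℕ)) : Prop :=
  ∀ S, Encodes S X G → Encodes (f S) X' G' ∧ Relation.ReflTransGen (GreedyStep n) S (f S)

theorem Does.id (n : ℕ) (X : Finset ℕ) (G : Set (Finset ℕ)) : Does n (fun S => S) X G X G :=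
  fun _ h => ⟨h, .refl⟩

theorem Does.comp {n : ℕ} {f g : State → State} {X X' X'' : Finset ℕ}
    {G G' G'' : Set (Finset ℕ)} (hf : Does n f X G X' G') (hg : Does n g X' G' X'' G'') :
    Does n (fun S => g (f S)) X G X'' G'' := by
  intro S hS
  obtain ⟨h1, h2⟩ := hf S hS
  obtain ⟨h3, h4⟩ := hg _ h1
  exact ⟨h3, h2.trans h4⟩

theorem Does.of_eq {n : ℕ} {f : State → State} {X X' : Finset ℕ} {G G' G'' : Set (Finset ℕ)}
    (hf : Does n f X G X' G') (h : G' = G'') : Does n f X G X' G'' := h ▸ hf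

/-- The tree `X - c + d`. -/
def exch (X : Finset ℕ) (c d : ℕ) : Finset ℕ := insert d (X.erase c)

theorem mem_exch {X : Finset ℕ} {c d a : ℕ} : a ∈ exch X c d ↔ a = d ∨ (a ≠ c ∧ a ∈ X) := by
  simp [exch]

/-- A number that orders the edges at a vertex by the labels of their other ends: the spoke comes last,
also at `v_2`, where it has the code `3` and competes only with the code `5`. -/
def rk (c : ℕ) : ℕ := if c = 3 then 6 else if c % 2 = 0 then c + 2 else c

theorem rk_lt {k c d : ℕ} (hk : 2 ≤ k) (hc : Inc k c) (hd : Inc k d) (h : nb k c < nb k d) :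
    rk c < rk d := by
  unfold Inc at hc hd
  unfold nb at h
  unfold rk
  split_ifs at h <;> simp only [v_lt, lt_self_iff_false, not_top_lt, vInf] at h <;>
    split_ifs <;> omega

theorem move_enc {k c d : ℕ} (hk : 2 ≤ k) (hc : Inc k c) (hd : Inc k d) (X : Finset ℕ) :
    move (enc X) (v k) (nb k c) (nb k d) = enc (exch X c d) := by
  rw [move, exch, enc_exchange, edge_eq hk hc, edge_eq hk hd]

/-- A pivot at `v k` is a greedy step as soon as all spanning trees that differ from `X` in codes
below `2 * k` only are in `G`, and so are the results of the pivots at `v k` of higher priority. -/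
theorem Does.pivot {n k c d : ℕ} {x y : Label} {X : Finset ℕ} {G : Set (Finset ℕ)} (hk : 2 ≤ k)
    (hkn : k ≤ n) (hc : Inc k c) (hd : Inc k d) (hx : x = nb k c) (hy : y = nb k d) (hcX : c ∈ X)
    (hdX : d ∉ X) (hX : Valid n X) (hX' : Valid n (exch X c d)) (hnew : exch X c d ∉ G)
    (low : ∀ Y, Valid n Y → Agree (2 * k - 1) X Y → Y ∈ G)
    (same : ∀ c' d', Inc k c' → Inc k d' → c' ∈ X → d' ∉ X →
      (rk c' < rk c ∨ c' = c ∧ rk d' < rk d) → Valid n (exch X c' d') → exch X c' d' ∈ G) :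
    Does n (step (v k) x y) X G (exch X c d) (insert (exch X c d) G) := by
  subst hx hy
  have hn : 2 ≤ n := hk.trans hkn
  intro S hS
  have hmove : move S.tree (v k) (nb k c) (nb k d) = enc (exch X c d) := by
    rw [hS.tree, move_enc hk hc hd]
  have hd' : d ∈ exch X c d := mem_exch.2 (Or.inl rfl)
  refine ⟨⟨hmove, fun Y => ?_⟩, .single ⟨v k, (v_mem_vertexList hn).2 ⟨hk, hkn⟩, nb k c,
    nb_mem_vertexList hk hkn hc (hX.code hn hcX).2.2, nb k d,
    nb_mem_vertexList hk hkn hd (hX'.code hn hd').2.2, ?_, ?_, rfl, ?_, ?_, ?_⟩⟩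
  · simp only [step, hmove, List.mem_append, List.mem_singleton, hS.printed,
      enc_injective.eq_iff, Set.mem_insert_iff]
    tauto
  · rwa [hS.tree, ← edge_eq hk hc, edge_mem_enc]
  · rwa [hS.tree, ← edge_eq hk hd, edge_mem_enc]
  · rwa [hmove, isSpanningTree_enc hn]
  · rwa [hmove, hS.printed]
  · intro u' hu' x' _ y' _ hlt hx' hy' htree
    obtain ⟨i, rfl, hik⟩ : ∃ i, u' = v i ∧ i ≤ k := by
      induction u' using WithTop.recTopCoe with
      | top => simp [v] at hlt
      | coe i =>
        refine ⟨i, rfl, ?_⟩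
        rcases hlt with h | ⟨h, -⟩
        · exact (v_lt.1 h).le
        · exact (v_inj.1 h).le
    rw [v_lt, v_inj] at hlt
    have hi := ((v_mem_vertexList hn).1 hu').1
    obtain ⟨Y, hY, hYV⟩ := (isSpanningTree_iff hn).1 htree
    rw [hS.tree] at hx' hy' hY ⊢
    obtain ⟨c', hc', hce⟩ := mem_enc.1 hx'
    obtain ⟨-, hci, rfl⟩ := inc_of_edge_eq (hX.code hn hc').1 (hX.code hn hc').2.1 hce
    have hyY : s(v i, y') ∈ enc Y := by
      rw [← hY]
      exact Finset.mem_insert_self _ _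
    obtain ⟨d', hd', hde⟩ := mem_enc.1 hyY
    obtain ⟨-, hdi, rfl⟩ := inc_of_edge_eq (hYV.code hn hd').1 (hYV.code hn hd').2.1 hde
    rw [move_enc hi hci hdi] at hY ⊢
    obtain rfl := enc_injective hY
    rw [hS.printed]
    rw [← hde, edge_mem_enc] at hy'
    rcases Nat.lt_or_ge i k with h | h
    · refine low _ hYV fun a ha => ?_
      unfold Inc at hci hdi
      rw [mem_exch]
      have h1 : a ≠ c' := by omega
      have h2 : a ≠ d' := by omega
      simp [h1, h2]
    · obtain rfl : i = k := le_antisymm hik h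
      refine same c' d' hci hdi hc' hy' ?_ hYV
      rcases hlt with h | ⟨-, h | ⟨h, h'⟩⟩
      · omega
      · exact Or.inl (rk_lt hk hci hc h)
      · refine Or.inr ⟨edge_injective ?_, rk_lt hk hdi hd h'⟩
        rw [edge_eq hk hci, edge_eq hk hc, h]

/-! ### The classes of trees listed by the recursive procedures -/

/-- The initial trees: up to `v k`, the tree is the path `v_∞, v_2, …, v_k`. -/
def PathTo : ℕ → Finset ℕ → Prop
  | 0, _ => False
  | 1, _ => False
  | 2, X => Conn 2 true X
  | k + 3, X => PathTo (k + 2) X ∧ 2 * k + 5 ∈ X ∧ 2 * k + 6 ∉ X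

/-- The first forest, up to `v k`, of the part of the listing in which `v k` is separated from
`v_∞`. -/
def OpenStart : ℕ → Finset ℕ → Prop
  | 0, _ => False
  | 1, _ => False
  | 2, X => Conn 2 false X
  | k + 3, X => PathTo (k + 2) X ∧ 2 * k + 5 ∉ X ∧ 2 * k + 6 ∉ X

/-- The shape, up to `v k`, of the tree at which `gen k _ false` ends. -/
def EndAt : ℕ → Finset ℕ → Prop
  | 0, _ => False
  | 1, _ => False
  | 2, X => Conn 2 true X
  | 3, X => Conn 2 false X ∧ 5 ∈ X ∧ 6 ∈ X
  | 4, X => Conn 2 false X ∧ 5 ∈ X ∧ 6 ∉ X ∧ 7 ∈ X ∧ 8 ∈ X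
  | k + 5, X => EndAt (k + 2) X ∧ 2 * k + 5 ∉ X ∧ 2 * k + 6 ∈ X ∧ 2 * k + 7 ∉ X ∧
      2 * k + 8 ∉ X ∧ 2 * k + 9 ∈ X ∧ 2 * k + 10 ∈ X

/-- The last forest, up to `v k`, of the part of the listing in which `v k` is separated from
`v_∞`. -/
def OpenEnd : ℕ → Finset ℕ → Prop
  | 0, _ => False
  | 1, _ => False
  | 2, X => Conn 2 false X
  | 3, X => Conn 2 false X ∧ 5 ∈ X ∧ 6 ∉ X
  | k + 4, X => EndAt (k + 2) X ∧ 2 * k + 5 ∉ X ∧ 2 * k + 6 ∈ X ∧ 2 * k + 7 ∉ X ∧ 2 * k + 8 ∉ X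

theorem pathTo_succ {k : ℕ} (hk : 2 ≤ k) {X : Finset ℕ} :
    PathTo (k + 1) X ↔ PathTo k X ∧ 2 * k + 1 ∈ X ∧ 2 * k + 2 ∉ X := by
  obtain ⟨k, rfl⟩ := Nat.exists_eq_add_of_le' hk
  rfl

theorem openStart_succ {k : ℕ} (hk : 2 ≤ k) {X : Finset ℕ} :
    OpenStart (k + 1) X ↔ PathTo k X ∧ 2 * k + 1 ∉ X ∧ 2 * k + 2 ∉ X := by
  obtain ⟨k, rfl⟩ := Nat.exists_eq_add_of_le' hk
  rfl

theorem endAt_succ {k : ℕ} (hk : 2 ≤ k) {X : Finset ℕ} :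
    EndAt (k + 1) X ↔ OpenEnd k X ∧ 2 * k + 1 ∈ X ∧ 2 * k + 2 ∈ X := by
  match k, hk with
  | 2, _ => exact Iff.rfl
  | 3, _ =>
    simp only [EndAt, OpenEnd, and_assoc]
  | k + 4, _ =>
    simp only [EndAt, OpenEnd, and_assoc]
    rfl

theorem openEnd_succ {k : ℕ} (hk : 3 ≤ k) {X : Finset ℕ} :
    OpenEnd (k + 1) X ↔ EndAt (k - 1) X ∧ 2 * k - 1 ∉ X ∧ 2 * k ∈ X ∧ 2 * k + 1 ∉ X ∧
      2 * k + 2 ∉ X := by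
  obtain ⟨k, rfl⟩ := Nat.exists_eq_add_of_le' hk
  rfl

theorem pathTo_conn {k : ℕ} (hk : 2 ≤ k) {X : Finset ℕ} (h : PathTo k X) : Conn k true X := by
  induction k, hk using Nat.le_induction with
  | base => exact h
  | succ k hk ih =>
    rw [pathTo_succ hk] at h
    rw [conn_succ_true hk]
    exact Or.inl ⟨ih h.1, Or.inl h.2⟩

theorem openStart_conn {k : ℕ} (hk : 2 ≤ k) {X : Finset ℕ} (h : OpenStart k X) :
    Conn k false X := by
  obtain ⟨k, rfl⟩ := Nat.exists_eq_add_of_le' hk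
  cases k with
  | zero => exact h
  | succ k =>
    rw [show k + 1 + 2 = k + 2 + 1 from rfl, openStart_succ (by omega)] at h
    rw [show k + 1 + 2 = k + 2 + 1 from rfl, conn_succ_false (by omega)]
    exact Or.inl ⟨pathTo_conn (by omega) h.1, h.2⟩

theorem endAt_conn (k : ℕ) {X : Finset ℕ} (h : EndAt (k + 2) X) : Conn (k + 2) true X := by
  match k with
  | 0 => exact h
  | 1 => exact Or.inr h
  | 2 =>
    obtain ⟨h2, h5, h6, h7, h8⟩ := h
    exact Or.inr ⟨Or.inr ⟨h2, h5, h6⟩, h7, h8⟩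
  | k + 3 =>
    obtain ⟨h2, h5, h6, h7, h8, h9, h10⟩ := h
    have h := endAt_conn k h2
    exact Or.inr ⟨Or.inl ⟨Or.inl ⟨h, Or.inr ⟨h5, h6⟩⟩, h7, h8⟩, h9, h10⟩

theorem openEnd_conn {k : ℕ} (hk : 2 ≤ k) {X : Finset ℕ} (h : OpenEnd k X) :
    Conn k false X := by
  match k, hk with
  | 2, _ => exact h
  | 3, _ => exact Or.inr h
  | k + 4, _ =>
    obtain ⟨h2, h5, h6, h7, h8⟩ := h
    exact Or.inl ⟨Or.inl ⟨endAt_conn k h2, Or.inr ⟨h5, h6⟩⟩, h7, h8⟩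

theorem pathTo_congr {k : ℕ} (hk : 2 ≤ k) {X Y : Finset ℕ}
    (h : ∀ c, c ≤ 2 * k → (c ∈ Y ↔ c ∈ X)) (hX : PathTo k X) : PathTo k Y := by
  induction k, hk using Nat.le_induction with
  | base => exact conn_congr le_rfl h hX
  | succ k hk ih =>
    rw [pathTo_succ hk] at hX ⊢
    rw [h _ (by omega), h _ (by omega)]
    exact ⟨ih (fun c hc => h c (by omega)) hX.1, hX.2⟩

theorem endAt_congr (k : ℕ) {X Y : Finset ℕ} (h : ∀ c, c ≤ 2 * (k + 2) → (c ∈ Y ↔ c ∈ X))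
    (hX : EndAt (k + 2) X) : EndAt (k + 2) Y := by
  match k with
  | 0 => exact conn_congr le_rfl h hX
  | 1 =>
    simp only [EndAt] at hX ⊢
    rw [h _ (by omega), h _ (by omega)]
    exact ⟨conn_congr le_rfl (fun c hc => h c (by omega)) hX.1, hX.2⟩
  | 2 =>
    simp only [EndAt] at hX ⊢
    rw [h _ (by omega), h _ (by omega), h _ (by omega), h _ (by omega)]
    exact ⟨conn_congr le_rfl (fun c hc => h c (by omega)) hX.1, hX.2⟩
  | k + 3 =>
    simp only [EndAt] at hX ⊢
    rw [h _ (by omega), h _ (by omega), h _ (by omega), h _ (by omega), h _ (by omega),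
      h _ (by omega)]
    exact ⟨endAt_congr k (fun c hc => h c (by omega)) hX.1, hX.2⟩

theorem openEnd_congr {k : ℕ} (hk : 2 ≤ k) {X Y : Finset ℕ}
    (h : ∀ c, c ≤ 2 * k → (c ∈ Y ↔ c ∈ X)) (hX : OpenEnd k X) : OpenEnd k Y := by
  match k, hk with
  | 2, _ => exact conn_congr le_rfl h hX
  | 3, _ =>
    simp only [OpenEnd] at hX ⊢
    rw [h _ (by omega), h _ (by omega)]
    exact ⟨conn_congr le_rfl (fun c hc => h c (by omega)) hX.1, hX.2⟩
  | k + 4, _ =>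
    simp only [OpenEnd] at hX ⊢
    rw [h _ (by omega), h _ (by omega), h _ (by omega), h _ (by omega)]
    exact ⟨endAt_congr k (fun c hc => h c (by omega)) hX.1, hX.2⟩

/-- Moving the last edge of the path from `v_{k-1} v_k` to `v_k v_{k+1}`. -/
theorem PathTo.exch {k : ℕ} (hk : 2 ≤ k) {X : Finset ℕ} (h : PathTo k X) :
    OpenStart k (exch X (2 * k - 1) (2 * k + 1)) := by
  rcases Nat.eq_or_lt_of_le hk with rfl | hk3
  · obtain ⟨h1, h2, h3⟩ := h
    refine ⟨?_, ?_, fun c hc => ?_⟩ <;> simp only [mem_exch] at * <;> grind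
  · obtain ⟨k, rfl⟩ := Nat.exists_eq_add_of_le' hk3
    rw [pathTo_succ (by omega)] at h
    rw [openStart_succ (by omega)]
    refine ⟨pathTo_congr (by omega) (fun c hc => ?_) h.1, ?_, ?_⟩ <;> rw [mem_exch] <;> grind

theorem OpenStart.exch {k : ℕ} (hk : 2 ≤ k) {X : Finset ℕ} (h : OpenStart k X) :
    PathTo k (exch X (2 * k + 1) (2 * k - 1)) := by
  rcases Nat.eq_or_lt_of_le hk with rfl | hk3
  · obtain ⟨h1, h2, h3⟩ := h
    refine ⟨?_, ?_, fun c hc => ?_⟩ <;> simp only [mem_exch] at * <;> grind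
  · obtain ⟨k, rfl⟩ := Nat.exists_eq_add_of_le' hk3
    rw [openStart_succ (by omega)] at h
    rw [pathTo_succ (by omega)]
    refine ⟨pathTo_congr (by omega) (fun c hc => ?_) h.1, ?_, ?_⟩ <;> rw [mem_exch] <;> grind

theorem PathTo.mem {k : ℕ} (hk : 2 ≤ k) {X : Finset ℕ} (h : PathTo k X) : 2 * k - 1 ∈ X := by
  rcases Nat.eq_or_lt_of_le hk with rfl | hk3
  · exact h.1.2 rfl
  · obtain ⟨k, rfl⟩ := Nat.exists_eq_add_of_le' hk3
    exact h.2.1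

theorem OpenStart.not_mem {k : ℕ} (hk : 2 ≤ k) {X : Finset ℕ} (h : OpenStart k X) :
    2 * k - 1 ∉ X := by
  rcases Nat.eq_or_lt_of_le hk with rfl | hk3
  · exact fun h3 => Bool.noConfusion (h.1.1 h3)
  · obtain ⟨k, rfl⟩ := Nat.exists_eq_add_of_le' hk3
    exact h.2.1

/-- The part of the tree `X` up to `v k`, where the edge from `v k` to `v_{k+1}` takes the role of
the spoke at `v k` if `e` is true, is a spanning tree of `F_k`. -/
def Tree (k : ℕ) : Bool → Finset ℕ → Prop
  | false, X => Conn k true X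
  | true, X => (Conn k true X ∧ 2 * k + 1 ∉ X ∧ 2 * k ∉ X) ∨ (Conn k false X ∧ 2 * k + 1 ∈ X)

theorem conn_false_spoke {k : ℕ} (hk : 2 ≤ k) {X : Finset ℕ} (h : Conn k false X) :
    2 * k ∉ X := by
  rcases Nat.eq_or_lt_of_le hk with rfl | hk3
  · exact h.2.1
  · obtain ⟨k, rfl⟩ := Nat.exists_eq_add_of_le' hk3
    rw [conn_succ_false (by omega)] at h
    rcases h with h | h <;> exact h.2.2

theorem tree_succ {k : ℕ} (hk : 2 ≤ k) {e : Bool} {X : Finset ℕ} :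
    Tree (k + 1) e X ↔ (e = true → 2 * k + 2 ∉ X) ∧
      ((Conn k true X ∧ (2 * k + 1 ∈ X ↔ 2 * k + 2 + e.toNat ∉ X)) ∨
        (Conn k false X ∧ 2 * k + 1 ∈ X ∧ 2 * k + 2 + e.toNat ∈ X)) := by
  cases e
  · simp only [Tree, conn_succ_true hk, Bool.toNat_false, add_zero, Bool.false_eq_true,
      false_imp_iff, true_and]
    tauto
  · simp only [Tree, conn_succ_true hk, conn_succ_false hk, Bool.toNat_true, true_imp_iff,
      mul_add, mul_one, add_assoc, Nat.reduceAdd]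
    tauto

theorem conn_false_succ {k : ℕ} (hk : 2 ≤ k) {X : Finset ℕ} :
    Conn (k + 1) false X ↔ 2 * k + 2 ∉ X ∧
      (Tree k true X ∨ (Conn k true X ∧ 2 * k ∈ X ∧ 2 * k + 1 ∉ X)) := by
  rw [conn_succ_false hk, Tree]
  tauto

/-- Trees with the same codes outside the region governed by `Tree k e` are spanning trees of `F_n` or
not together. -/
theorem tree_valid {n k : ℕ} (hk : 2 ≤ k) {e : Bool} (hkn : k + e.toNat ≤ n) {X Y : Finset ℕ}
    (hV : Valid n X) (hX : Tree k e X) (hY : Tree k e Y) (h : Agree (2 * k + e.toNat) X Y) :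
    Valid n Y := by
  cases e
  · exact hV.transfer hk hkn hX hY h
  · simp only [Bool.toNat_true] at hkn h
    have h2 := h (2 * k + 2) (by omega)
    have hA : Agree (2 * (k + 1)) X Y := h.mono (by omega)
    simp only [Tree] at hX hY
    by_cases h3 : 2 * k + 2 ∈ X
    · exact hV.transfer (b := true) (by omega) hkn (by rw [conn_succ_true hk]; tauto)
        (by rw [conn_succ_true hk]; tauto) hA
    · exact hV.transfer (b := false) (by omega) hkn (by rw [conn_succ_false hk]; tauto)
        (by rw [conn_succ_false hk]; tauto) hA

/-- A change in codes below `2 * k`, such as a pivot around `v i` with `i < k`, that leads to a spanning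
tree of `F_n` preserves `Tree k e`. -/
theorem tree_same {n k : ℕ} (hk : 2 ≤ k) {e : Bool} (hkn : k ≤ n) {X Y : Finset ℕ}
    (hX : Valid n X) (hY : Valid n Y) (h : Agree (2 * k - 1) X Y) (hT : Tree k e X) :
    Tree k e Y := by
  have h1 := fun b => hX.same (b := b) hk hkn hY (h.mono (by omega))
  have h2 := h (2 * k) (by omega)
  have h3 := h (2 * k + 1) (by omega)
  have h4 := h1 true
  have h5 := h1 false
  cases e <;> simp only [Tree] at hT ⊢ <;> tauto

/-- The trees listed by `gen k true e` from `X` on. -/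
def AllTrees (k : ℕ) (e : Bool) (X : Finset ℕ) : Set (Finset ℕ) :=
  {Y | Agree (2 * k + e.toNat) X Y ∧ Tree k e Y}

/-- The trees listed by `gen k false e` from `X` on: those that contain the spoke at `v k` or the
edge that takes its role. -/
def TopTrees (k : ℕ) (e : Bool) (X : Finset ℕ) : Set (Finset ℕ) :=
  {Y | Agree (2 * k + e.toNat) X Y ∧ Tree k e Y ∧ 2 * k + e.toNat ∈ Y}

/-- The trees that contain `X` beyond `v k` and whose part up to `v k` separates `v k` from
`v_∞`. -/
def OpenTrees (k : ℕ) (X : Finset ℕ) : Set (Finset ℕ) :=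
  {Y | Agree (2 * k) X Y ∧ Conn k false Y}

/-! ### The recursive procedures perform greedy steps -/

/-- The part of `gen (k + 1) _ _` in which `v k` is separated from `v_∞` in `F_k`. -/
def openGen : ℕ → State → State
  | 0, S => S
  | 1, S => S
  | 2, S => S
  | 3, S => gen 2 true true S
  | k + 4, S =>
    revGen (k + 3) false false (step (v (k + 3)) (v (k + 4)) vInf (gen (k + 3) true true S))

/-- The part of `revGen (k + 1) _ _` in which `v k` is separated from `v_∞` in `F_k`. -/
def openRev : ℕ → State → State
  | 0, S => S
  | 1, S => S
  | 2, S => S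
  | 3, S => revGen 2 true true S
  | k + 4, S =>
    revGen (k + 3) true true (step (v (k + 3)) vInf (v (k + 4)) (gen (k + 3) false false S))

theorem gen_succ_true {k : ℕ} (hk : 2 ≤ k) (e : Bool) :
    gen (k + 1) true e = fun S => gen (k + 1) false e
      (step (v (k + 1)) (v k) (if e then v (k + 2) else vInf) (gen k true false S)) := by
  funext S
  match k, hk with
  | 2, _ => simp [gen]
  | k + 3, _ => simp [gen]

theorem gen_succ_false {k : ℕ} (hk : 2 ≤ k) (e : Bool) :
    gen (k + 1) false e = fun S => openGen k
      (step (v k) (nb k (2 * k - 1)) (v (k + 1)) (revGen k true false S)) := by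
  funext S
  match k, hk with
  | 2, _ => simp [gen, revGen, openGen, nb]
  | 3, _ => simp [gen, revGen, openGen, nb]
  | k + 4, _ =>
    have h : nb (k + 4) (2 * (k + 4) - 1) = v (k + 3) := by
      rw [nb, if_neg (by omega), if_neg (by omega)]
      rfl
    rw [h]
    simp [gen, openGen]

theorem revGen_succ_true {k : ℕ} (hk : 2 ≤ k) (e : Bool) :
    revGen (k + 1) true e = fun S => revGen k true false
      (step (v (k + 1)) (if e then v (k + 2) else vInf) (v k) (revGen (k + 1) false e S)) := by
  funext S
  match k, hk with
  | 2, _ => simp [revGen]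
  | k + 3, _ => simp [revGen]

theorem revGen_succ_false {k : ℕ} (hk : 2 ≤ k) (e : Bool) :
    revGen (k + 1) false e = fun S => gen k true false
      (step (v k) (v (k + 1)) (nb k (2 * k - 1)) (openRev k S)) := by
  funext S
  match k, hk with
  | 2, _ => simp [gen, revGen, openRev, nb]
  | 3, _ => simp [gen, revGen, openRev, nb]
  | k + 4, _ =>
    have h : nb (k + 4) (2 * (k + 4) - 1) = v (k + 3) := by
      rw [nb, if_neg (by omega), if_neg (by omega)]
      rfl
    rw [h]
    simp [revGen, openRev]

/-- Run from any spanning tree `X` with property `start`, the procedure `f` performs greedy steps only,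
lists exactly the trees of the class `C X`, and ends at a tree with property `fin`. It is assumed
that, when it is called, `X` is the only tree of the class in the set `G` of listed trees, and
that `X` and `G` satisfy the condition `ctx` on the call. -/
def Lists (n : ℕ) (f : State → State) (start fin : Finset ℕ → Prop)
    (C : Finset ℕ → Set (Finset ℕ)) (ctx : Finset ℕ → Set (Finset ℕ) → Prop) : Prop :=
  ∀ X G, start X → Valid n X → X ∈ G → (∀ Y ∈ C X, Y ∈ G → Y = X) → ctx X G →
    ∃ X' ∈ C X, fin X' ∧ Valid n X' ∧ Does n f X G X' (G ∪ C X)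

/-- The first tree of `gen k true e`. -/
def AllStart (k : ℕ) (e : Bool) (X : Finset ℕ) : Prop :=
  PathTo k X ∧ (e = true → 2 * k + 1 ∉ X)

/-- The last tree of `gen k _ e`. -/
def AllEnd : ℕ → Bool → Finset ℕ → Prop
  | 2, false, X => Conn 2 true X
  | 2, true, X => Conn 2 false X ∧ 5 ∈ X
  | k, e, X => OpenEnd (k - 1) X ∧ 2 * k - 1 ∈ X ∧ 2 * k + e.toNat ∈ X ∧ (e = true → 2 * k ∉ X)

/-- The condition on the spoke at `v (k + 1)` and the edge to `v (k + 2)`: the one selected by `e`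
is present and, if this is the latter, the spoke is absent. -/
def HasTop (k : ℕ) (e : Bool) (X : Finset ℕ) : Prop :=
  2 * k + 2 + e.toNat ∈ X ∧ (e = true → 2 * k + 2 ∉ X)

/-- The first tree of `gen (k + 1) false e`. -/
def TopStart (k : ℕ) (e : Bool) (X : Finset ℕ) : Prop :=
  EndAt k X ∧ 2 * k + 1 ∉ X ∧ HasTop k e X

/-- The context of a call `gen k true false`: pivots of `v k` from `v_{k-1}` to `v_{k+1}`, which have
priority over those from `v_{k-1}` to `v_∞`, lead to trees that are already listed. -/
def GenCtx (n k : ℕ) (X : Finset ℕ) (G : Set (Finset ℕ)) : Prop :=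
  2 * k + 1 ∉ X → ∀ Y, Valid n Y → Agree (2 * k + 1) X Y → 2 * k + 1 ∈ Y → Y ∈ G

/-- The context of a call `revGen k true false`: an edge between `v k` and `v_{k+1}` can not be removed
by a change in the smaller codes, so pivots of `v k` that remove it give no tree. -/
def RevCtx (n k : ℕ) (X : Finset ℕ) : Prop :=
  2 * k + 1 ∈ X → ∀ Y, Valid n Y → Agree (2 * k + 1) X Y → 2 * k + 1 ∈ Y

/-- The specification of `gen k true e`. -/
def GenAll (n k : ℕ) (e : Bool) : Prop :=
  k + e.toNat ≤ n → Lists n (gen k true e) (AllStart k e) (AllEnd k e) (AllTrees k e)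
    (fun X G => e = false → GenCtx n k X G)

/-- The specification of `revGen k true e`. -/
def RevAll (n k : ℕ) (e : Bool) : Prop :=
  k + e.toNat ≤ n → Lists n (revGen k true e) (AllEnd k e) (AllStart k e) (AllTrees k e)
    (fun X _ => e = false → RevCtx n k X)

/-- The specification of `gen (k + 1) false e`. -/
def GenTop (n k : ℕ) (e : Bool) : Prop :=
  k + 1 + e.toNat ≤ n → Lists n (gen (k + 1) false e) (TopStart k e) (AllEnd (k + 1) e)
    (TopTrees (k + 1) e) (fun _ _ => True)

/-- The specification of `revGen (k + 1) false e`. -/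
def RevTop (n k : ℕ) (e : Bool) : Prop :=
  k + 1 + e.toNat ≤ n → Lists n (revGen (k + 1) false e) (AllEnd (k + 1) e) (TopStart k e)
    (TopTrees (k + 1) e) (fun _ _ => True)

/-- The specification of `openGen k`. -/
def GenOpen (n k : ℕ) : Prop :=
  k + 1 ≤ n → Lists n (openGen k) (OpenStart k) (OpenEnd k) (OpenTrees k) (fun _ _ => True)

/-- The specification of `openRev k`. -/
def RevOpen (n k : ℕ) : Prop :=
  k + 1 ≤ n → Lists n (openRev k) (OpenEnd k) (OpenStart k) (OpenTrees k) (fun _ _ => True)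

theorem allEnd_succ {k : ℕ} (hk : 2 ≤ k) {e : Bool} {X : Finset ℕ} :
    AllEnd (k + 1) e X ↔ OpenEnd k X ∧ 2 * k + 1 ∈ X ∧ HasTop k e X := by
  obtain ⟨k, rfl⟩ := Nat.exists_eq_add_of_le' hk
  rfl

theorem allEnd_false {k : ℕ} (hk : 2 ≤ k) {X : Finset ℕ} : AllEnd k false X ↔ EndAt k X := by
  rcases Nat.eq_or_lt_of_le hk with rfl | hk3
  · exact Iff.rfl
  · obtain ⟨k, rfl⟩ := Nat.exists_eq_add_of_le' hk3
    rw [allEnd_succ (by omega), endAt_succ (by omega)]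
    simp [HasTop]

/-- Two listings that are joined by a pivot of `v k`, if their classes partition `C`. -/
theorem Lists.join {n k c d : ℕ} {x y : Label} {f g : State → State}
    {s₁ f₁ s₂ f₂ fin : Finset ℕ → Prop} {C₁ C₂ : Finset ℕ → Set (Finset ℕ)} {C : Set (Finset ℕ)}
    {ctx₁ ctx₂ : Finset ℕ → Set (Finset ℕ) → Prop} (hf : Lists n f s₁ f₁ C₁ ctx₁)
    (hg : Lists n g s₂ f₂ C₂ ctx₂) (hk : 2 ≤ k) (hkn : k ≤ n) (hc : Inc k c) (hd : Inc k d)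
    (hx : x = nb k c) (hy : y = nb k d) {X : Finset ℕ} {G : Set (Finset ℕ)} (hs : s₁ X)
    (hV : Valid n X) (hXG : X ∈ G) (hfresh : ∀ Y ∈ C, Y ∈ G → Y = X) (hctx : ctx₁ X G)
    (hX : X ∈ C₁ X) (hsub : C₁ X ⊆ C)
    (hstep : ∀ X₁ ∈ C₁ X, f₁ X₁ → Valid n X₁ → c ∈ X₁ ∧ d ∉ X₁ ∧ Valid n (exch X₁ c d) ∧
      s₂ (exch X₁ c d) ∧ exch X₁ c d ∈ C₂ (exch X₁ c d) ∧
      (∀ Y, Valid n Y → Agree (2 * k - 1) X₁ Y → Y ∈ C₁ X) ∧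
      (∀ c' d', Inc k c' → Inc k d' → c' ∈ X₁ → d' ∉ X₁ →
        (rk c' < rk c ∨ c' = c ∧ rk d' < rk d) → Valid n (exch X₁ c' d') →
        exch X₁ c' d' ∈ G ∪ C₁ X) ∧
      ctx₂ (exch X₁ c d) (insert (exch X₁ c d) (G ∪ C₁ X)) ∧
      (∀ Y, Y ∈ C ↔ Y ∈ C₁ X ∨ Y ∈ C₂ (exch X₁ c d)) ∧
      (∀ Y ∈ C₁ X, Y ∉ C₂ (exch X₁ c d)) ∧
      (∀ Y ∈ C₂ (exch X₁ c d), f₂ Y → fin Y)) :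
    ∃ X' ∈ C, fin X' ∧ Valid n X' ∧ Does n (fun S => g (step (v k) x y (f S))) X G X' (G ∪ C) := by
  obtain ⟨X₁, hX₁, hf₁, hV₁, hdo₁⟩ :=
    hf X G hs hV hXG (fun Y hY => hfresh Y (hsub hY)) hctx
  obtain ⟨hc₁, hd₁, hV₂, hs₂, hmem, hlow, hsame, hctx₂, hC, hdisj, hfin⟩ := hstep X₁ hX₁ hf₁ hV₁
  have hold : ∀ Y ∈ C₂ (exch X₁ c d), Y ∉ G ∪ C₁ X := by
    rintro Y hY (h | h)
    · exact hdisj X hX (hfresh Y ((hC Y).2 (Or.inr hY)) h ▸ hY)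
    · exact hdisj Y h hY
  have hdo₂ := Does.pivot hk hkn hc hd hx hy hc₁ hd₁ hV₁ hV₂ (hold _ hmem)
    (fun Y h h' => Or.inr (hlow Y h h')) hsame
  obtain ⟨X', hX', hf', hV', hdo₃⟩ := hg _ _ hs₂ hV₂ (Set.mem_insert _ _)
    (fun Y hY h => h.elim id fun h => absurd h (hold Y hY)) hctx₂
  refine ⟨X', (hC X').2 (Or.inr hX'), hfin X' hX' hf', hV', ((hdo₁.comp hdo₂).comp hdo₃).of_eq ?_⟩
  ext Y
  have := hC Y
  have : Y = exch X₁ c d → Y ∈ C₂ (exch X₁ c d) := fun h => h ▸ hmem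
  simp only [Set.mem_union, Set.mem_insert_iff]
  tauto

theorem inc_left (k : ℕ) (hk : 2 ≤ k) : Inc k (2 * k - 1) := Or.inl (by omega)

theorem inc_right (k : ℕ) : Inc k (2 * k + 1) := Or.inr (Or.inl rfl)

theorem nb_right (k : ℕ) (hk : 2 ≤ k) : v (k + 1) = nb k (2 * k + 1) := by
  rw [nb, if_neg (by omega), if_pos rfl]

theorem rk_right {k : ℕ} (hk : 2 ≤ k) : rk (2 * k + 1) = 2 * k + 1 := by
  rw [rk, if_neg (by omega), if_neg (by omega)]

theorem rk_spoke {k : ℕ} : rk (2 * k) = 2 * k + 2 := by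
  rw [rk, if_neg (by omega), if_pos (by omega)]

theorem rk_left {k : ℕ} (hk : 2 ≤ k) : k = 2 ∧ rk (2 * k - 1) = 6 ∨ rk (2 * k - 1) = 2 * k - 1 := by
  rcases Nat.eq_or_lt_of_le hk with rfl | hk
  · exact Or.inl ⟨rfl, rfl⟩
  · rw [rk, if_neg (by omega), if_neg (by omega)]
    exact Or.inr rfl

theorem Inc.cases {k c : ℕ} (hk : 2 ≤ k) (h : Inc k c) :
    c = 2 * k - 1 ∧ rk c = rk (2 * k - 1) ∨ c = 2 * k + 1 ∧ rk c = 2 * k + 1 ∨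
      c = 2 * k ∧ 3 ≤ k ∧ rk c = 2 * k + 2 := by
  rcases h with h | h | ⟨h, h3⟩
  · obtain rfl : c = 2 * k - 1 := by omega
    exact Or.inl ⟨rfl, rfl⟩
  · subst h
    exact Or.inr (Or.inl ⟨rfl, rk_right hk⟩)
  · subst h
    exact Or.inr (Or.inr ⟨rfl, h3, rk_spoke⟩)

theorem rk_left_right {k c d : ℕ} (hk : 2 ≤ k) (hc : Inc k c) (hd : Inc k d)
    (hlt : rk c < rk (2 * k - 1) ∨ c = 2 * k - 1 ∧ rk d < rk (2 * k + 1)) :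
    c = 2 * k + 1 ∨ d = 2 * k - 1 := by
  have hk2 : 2 ≤ k := by omega
  have h1 := hc.cases hk2
  have h2 := hd.cases hk2
  have h3 := rk_left hk2
  have h4 := rk_right hk2
  omega

theorem rk_right_left {k c d : ℕ} (hk : 2 ≤ k) (hc : Inc k c) (hd : Inc k d)
    (hlt : rk c < rk (2 * k + 1) ∨ c = 2 * k + 1 ∧ rk d < rk (2 * k - 1)) :
    c = 2 * k - 1 ∨ d = 2 * k + 1 := by
  have hk2 : 2 ≤ k := by omega
  have h1 := hc.cases hk2
  have h2 := hd.cases hk2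
  have h3 := rk_left hk2
  have h4 := rk_right hk2
  omega

theorem rk_left_spoke {k c d : ℕ} (hk : 3 ≤ k) (hc : Inc k c) (hd : Inc k d)
    (hlt : rk c < rk (2 * k - 1) ∨ c = 2 * k - 1 ∧ rk d < rk (2 * k)) :
    c = 2 * k - 1 ∧ (d = 2 * k - 1 ∨ d = 2 * k + 1) := by
  have hk2 : 2 ≤ k := by omega
  have h1 := hc.cases hk2
  have h2 := hd.cases hk2
  have h3 := rk_left hk2
  have h4 := rk_right hk2
  have h5 := @rk_spoke k
  omega

theorem rk_spoke_left {k c d : ℕ} (hk : 3 ≤ k) (hc : Inc k c) (hd : Inc k d)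
    (hlt : rk c < rk (2 * k) ∨ c = 2 * k ∧ rk d < rk (2 * k - 1)) :
    c = 2 * k - 1 ∨ c = 2 * k + 1 := by
  have hk2 : 2 ≤ k := by omega
  have h1 := hc.cases hk2
  have h2 := hd.cases hk2
  have h3 := rk_left hk2
  have h4 := rk_right hk2
  have h5 := @rk_spoke k
  omega

theorem rk_right_spoke {k c d : ℕ} (hk : 3 ≤ k) (hc : Inc k c) (hd : Inc k d)
    (hlt : rk c < rk (2 * k + 1) ∨ c = 2 * k + 1 ∧ rk d < rk (2 * k)) :
    c = 2 * k - 1 ∨ d = 2 * k - 1 ∨ d = 2 * k + 1 := by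
  have hk2 : 2 ≤ k := by omega
  have h1 := hc.cases hk2
  have h2 := hd.cases hk2
  have h3 := rk_left hk2
  have h4 := rk_right hk2
  have h5 := @rk_spoke k
  omega

theorem rk_spoke_right {k c d : ℕ} (hk : 3 ≤ k) (hc : Inc k c) (hd : Inc k d)
    (hlt : rk c < rk (2 * k) ∨ c = 2 * k ∧ rk d < rk (2 * k + 1)) :
    c = 2 * k - 1 ∨ c = 2 * k + 1 ∨ d = 2 * k - 1 := by
  have hk2 : 2 ≤ k := by omega
  have h1 := hc.cases hk2
  have h2 := hd.cases hk2
  have h3 := rk_left hk2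
  have h4 := rk_right hk2
  have h5 := @rk_spoke k
  omega

theorem HasTop.congr {k : ℕ} {e : Bool} {X Y : Finset ℕ} (h : Agree (2 * k + 1) X Y)
    (hX : HasTop k e X) : HasTop k e Y := by
  have h1 := h (2 * k + 2) (by omega)
  have h2 := h (2 * k + 2 + e.toNat) (by omega)
  unfold HasTop at *
  tauto

theorem agree_of_hasTop {k : ℕ} {e : Bool} {X Y : Finset ℕ} (hX : HasTop k e X) (hY : HasTop k e Y)
    (h : Agree (2 * (k + 1) + e.toNat) X Y) : Agree (2 * k + 1) X Y := by
  intro c hc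
  unfold HasTop at *
  rcases Nat.lt_or_ge (2 * (k + 1) + e.toNat) c with hlt | hle
  · exact h c hlt
  · cases e
    · simp only [Bool.toNat_false] at *
      obtain rfl : c = 2 * k + 2 := by omega
      exact iff_of_true hY.1 hX.1
    · simp only [Bool.toNat_true, true_imp_iff] at *
      have : c = 2 * k + 2 ∨ c = 2 * k + 2 + 1 := by omega
      rcases this with rfl | rfl
      · exact iff_of_false hY.2 hX.2
      · exact iff_of_true hY.1 hX.1

theorem mem_topTrees {k : ℕ} (hk : 2 ≤ k) {e : Bool} {X Y : Finset ℕ} (hX : HasTop k e X) :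
    Y ∈ TopTrees (k + 1) e X ↔ Agree (2 * k + 1) X Y ∧
      (Conn k true Y ∧ 2 * k + 1 ∉ Y ∨ Conn k false Y ∧ 2 * k + 1 ∈ Y) := by
  constructor
  · rintro ⟨h1, h2, h3 : 2 * k + 2 + e.toNat ∈ Y⟩
    rw [tree_succ hk] at h2
    exact ⟨agree_of_hasTop hX ⟨h3, h2.1⟩ h1, by tauto⟩
  · rintro ⟨h1, h2⟩
    have hY := hX.congr h1
    refine ⟨h1.mono (by omega), ?_, hY.1⟩
    rw [tree_succ hk]
    unfold HasTop at hY
    tauto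

theorem agree_of_code {k : ℕ} {X Y : Finset ℕ} (h : Agree (2 * k + 1) X Y)
    (h1 : 2 * k + 1 ∈ Y ↔ 2 * k + 1 ∈ X) : Agree (2 * k) X Y :=
  h.pred rfl h1

theorem EndAt.conn {k : ℕ} (hk : 2 ≤ k) {X : Finset ℕ} (h : EndAt k X) : Conn k true X := by
  have := endAt_conn (k - 2) (by rwa [Nat.sub_add_cancel hk])
  rwa [Nat.sub_add_cancel hk] at this

theorem agree_exch {m c d : ℕ} (X : Finset ℕ) (hc : c ≤ m) (hd : d ≤ m) :
    Agree m X (exch X c d) := by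
  intro a ha
  have h1 : a ≠ c := by omega
  have h2 : a ≠ d := by omega
  simp [mem_exch, h1, h2]

theorem mem_exch_new (X : Finset ℕ) (c d : ℕ) : d ∈ exch X c d := mem_exch.2 (Or.inl rfl)

theorem not_mem_exch_old (X : Finset ℕ) {c d : ℕ} (h : c ≠ d) : c ∉ exch X c d := by
  simp [mem_exch, h]

/-- The first part of `gen (k + 1) false e` lists the trees without the edge from `v k` to `v (k + 1)`;
in the second part this edge is present, and `v k` is separated from `v_∞` in `F_k`. -/
theorem genTop {n k : ℕ} (hk : 2 ≤ k) (e : Bool) (hrev : RevAll n k false) (hgen : GenOpen n k) :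
    GenTop n k e := by
  rintro hkn X G ⟨hE, hb, ht⟩ hV hXG hfresh -
  rw [gen_succ_false hk]
  refine Lists.join (hrev (by simp; omega)) (hgen (by omega)) hk (by omega) (inc_left k hk)
    (inc_right k) rfl (nb_right k hk) ((allEnd_false hk).2 hE) hV hXG hfresh
    (fun _ h => absurd h hb) ⟨Agree.refl _ _, hE.conn hk⟩ ?_ ?_
  · rintro Y ⟨hA, hY⟩
    rw [mem_topTrees hk ht]
    exact ⟨hA.mono (by simp), Or.inl ⟨hY, by rwa [hA _ (by simp)]⟩⟩
  · rintro X₁ ⟨hA : Agree (2 * k) X X₁, hT₁⟩ ⟨hp₁, -⟩ hV₁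
    have hs := hp₁.exch hk
    have hcs := openStart_conn hk hs
    have hA₁ : Agree (2 * k + 1) X₁ (exch X₁ (2 * k - 1) (2 * k + 1)) :=
      agree_exch _ (by omega) (by omega)
    have hAs := (hA.mono (Nat.le_succ _)).trans hA₁
    have hb₁ : 2 * k + 1 ∉ X₁ := by rwa [hA _ (by simp)]
    have hb₂ := mem_exch_new X₁ (2 * k - 1) (2 * k + 1)
    generalize exch X₁ (2 * k - 1) (2 * k + 1) = X₂ at *
    have hX₂ : X₂ ∈ TopTrees (k + 1) e X := (mem_topTrees hk ht).2 ⟨hAs, Or.inr ⟨hcs, hb₂⟩⟩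
    have hX : X ∈ TopTrees (k + 1) e X :=
      (mem_topTrees hk ht).2 ⟨Agree.refl _ _, Or.inl ⟨hE.conn hk, hb⟩⟩
    refine ⟨hp₁.mem hk, hb₁, tree_valid (by omega) hkn hV hX.2.1 hX₂.2.1 hX₂.1, hs,
      ⟨Agree.refl _ _, hcs⟩, ?_, ?_, trivial, ?_, ?_, ?_⟩
    · intro Y hY hAY
      exact ⟨hA.trans (hAY.mono (by simp)), tree_same hk (by omega) hV₁ hY hAY hT₁⟩
    · intro c d hc hd hcX hdX hlt _
      rcases rk_left_right hk hc hd hlt with rfl | rfl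
      · exact absurd hcX hb₁
      · exact absurd (hp₁.mem hk) hdX
    · intro Y
      rw [mem_topTrees hk ht]
      constructor
      · rintro ⟨h1, ⟨h2, h3⟩ | ⟨h2, h3⟩⟩
        · exact Or.inl ⟨agree_of_code h1 (iff_of_false h3 hb), h2⟩
        · exact Or.inr ⟨agree_of_code (hAs.symm.trans h1) (iff_of_true h3 hb₂), h2⟩
      · rintro (⟨h1, h2⟩ | ⟨h1, h2⟩)
        · exact ⟨h1.mono (by simp), Or.inl ⟨h2, by rwa [h1 _ (by simp)]⟩⟩
        · exact ⟨hAs.trans (h1.mono (by simp)), Or.inr ⟨h2, by rwa [h1 _ (by simp)]⟩⟩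
    · rintro Y ⟨-, h1⟩ ⟨-, h2⟩
      exact Bool.noConfusion (conn_state_unique hk h1 h2)
    · rintro Y ⟨hY, -⟩ hYE
      rw [allEnd_succ hk, hY (2 * k + 1) (by omega)]
      exact ⟨hYE, hb₂, ht.congr (hAs.trans (hY.mono (by omega)))⟩

/-- The reversal of `genTop`. -/
theorem revTop {n k : ℕ} (hk : 2 ≤ k) (e : Bool) (hrev : RevOpen n k) (hgen : GenAll n k false) :
    RevTop n k e := by
  intro hkn X G hE hV hXG hfresh _
  obtain ⟨hE, hb, ht⟩ := (allEnd_succ hk).1 hE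
  have hcX := openEnd_conn hk hE
  have hX : X ∈ TopTrees (k + 1) e X :=
    (mem_topTrees hk ht).2 ⟨Agree.refl _ _, Or.inr ⟨hcX, hb⟩⟩
  rw [revGen_succ_false hk]
  refine Lists.join (hrev (by omega)) (hgen (by simp; omega)) hk (by omega) (inc_right k)
    (inc_left k hk) (nb_right k hk) rfl hE hV hXG hfresh trivial ⟨Agree.refl _ _, hcX⟩ ?_ ?_
  · rintro Y ⟨hA, hY⟩
    rw [mem_topTrees hk ht]
    exact ⟨hA.mono (by simp), Or.inr ⟨hY, by rwa [hA _ (by simp)]⟩⟩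
  · rintro X₁ ⟨hA, hT₁⟩ hs₁ hV₁
    have hp := hs₁.exch hk
    have hcp := pathTo_conn hk hp
    have hA₁ : Agree (2 * k + 1) X₁ (exch X₁ (2 * k + 1) (2 * k - 1)) :=
      agree_exch _ (by omega) (by omega)
    have hAs := (hA.mono (Nat.le_succ _)).trans hA₁
    have hb₁ : 2 * k + 1 ∈ X₁ := by rwa [hA _ (by simp)]
    have hb₂ : 2 * k + 1 ∉ exch X₁ (2 * k + 1) (2 * k - 1) := not_mem_exch_old _ (by omega)
    generalize exch X₁ (2 * k + 1) (2 * k - 1) = X₂ at *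
    have hX₂ : X₂ ∈ TopTrees (k + 1) e X := (mem_topTrees hk ht).2 ⟨hAs, Or.inl ⟨hcp, hb₂⟩⟩
    have hV₂ : Valid n X₂ := tree_valid (by omega) hkn hV hX.2.1 hX₂.2.1 hX₂.1
    have ht₂ : HasTop k e X₂ := ht.congr hAs
    refine ⟨hb₁, hs₁.not_mem hk, hV₂, ⟨hp, by simp⟩, ⟨Agree.refl _ _, hcp⟩, ?_, ?_, ?_, ?_, ?_, ?_⟩
    · intro Y hY hAY
      exact ⟨hA.trans (hAY.mono (by simp)), hV₁.same hk (by omega) hY (hAY.mono (by omega)) hT₁⟩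
    · intro c d hc hd hcX hdX hlt _
      rcases rk_right_left hk hc hd hlt with rfl | rfl
      · exact absurd hcX (hs₁.not_mem hk)
      · exact absurd hb₁ hdX
    -- The trees with the edge from `v k` to `v (k + 1)` have all been listed by `openRev k`.
    · intro _ _ Y hY hAY hbY
      have htY := ht₂.congr hAY
      have hTY := tree_same (by omega) (by omega) hV₂ hY hAY hX₂.2.1
      rw [tree_succ hk] at hTY
      have hXY := hAs.trans hAY
      refine Or.inr (Or.inr ⟨agree_of_code hXY (iff_of_true hbY hb), ?_⟩)
      have := htY.1
      tauto
    · intro Y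
      rw [mem_topTrees hk ht]
      constructor
      · rintro ⟨h1, ⟨h2, h3⟩ | ⟨h2, h3⟩⟩
        · exact Or.inr ⟨agree_of_code (hAs.symm.trans h1) (iff_of_false h3 hb₂), h2⟩
        · exact Or.inl ⟨agree_of_code h1 (iff_of_true h3 hb), h2⟩
      · rintro (⟨h1, h2⟩ | ⟨h1, h2⟩)
        · exact ⟨h1.mono (by simp), Or.inr ⟨h2, by rwa [h1 _ (by simp)]⟩⟩
        · exact ⟨hAs.trans (h1.mono (by simp)), Or.inl ⟨h2, by rwa [h1 _ (by simp)]⟩⟩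
    · rintro Y ⟨-, h1⟩ ⟨-, h2⟩
      exact Bool.noConfusion (conn_state_unique hk h1 h2)
    · rintro Y ⟨hY, -⟩ hYE
      refine ⟨(allEnd_false hk).1 hYE, ?_, ht.congr (hAs.trans (hY.mono (by simp)))⟩
      rwa [hY (2 * k + 1) (by simp)]

/-- The trees of `AllTrees (k + 1) e X` are those in which `v (k + 1)` is a leaf attached to `v k`
and those that contain the edge selected by `e`. -/
theorem mem_allTrees_succ {k : ℕ} (hk : 2 ≤ k) {e : Bool} {X X' Y : Finset ℕ}
    (hX : 2 * k + 1 ∈ X) (hx : 2 * k + 2 + e.toNat ∉ X) (he : e = true → 2 * k + 2 ∉ X)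
    (hX' : Agree (2 * (k + 1) + e.toNat) X X') :
    Y ∈ AllTrees (k + 1) e X ↔ Y ∈ AllTrees k false X ∨ Y ∈ TopTrees (k + 1) e X' := by
  constructor
  · rintro ⟨h1, h2⟩
    by_cases hY : 2 * k + 2 + e.toNat ∈ Y
    · exact Or.inr ⟨hX'.symm.trans h1, h2, hY⟩
    · rw [tree_succ hk] at h2
      refine Or.inl ⟨?_, show Conn k true Y by tauto⟩
      intro c hc
      rcases Nat.lt_or_ge (2 * (k + 1) + e.toNat) c with hlt | hle
      · exact h1 c hlt
      · have hbY : 2 * k + 1 ∈ Y := by tauto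
        cases e
        · simp only [Bool.toNat_false] at *
          have : c = 2 * k + 1 ∨ c = 2 * k + 2 := by omega
          rcases this with rfl | rfl
          · exact iff_of_true hbY hX
          · exact iff_of_false hY hx
        · simp only [Bool.toNat_true, Bool.toNat_false, true_imp_iff] at *
          have : c = 2 * k + 1 ∨ c = 2 * k + 2 ∨ c = 2 * k + 2 + 1 := by omega
          rcases this with rfl | rfl | rfl
          · exact iff_of_true hbY hX
          · exact iff_of_false h2.1 he
          · exact iff_of_false hY hx
  · rintro (⟨h1, h2⟩ | ⟨h1, h2, -⟩)
    · refine ⟨h1.mono (by simp; omega), ?_⟩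
      rw [tree_succ hk, h1 (2 * k + 1) (by simp), h1 (2 * k + 2) (by simp),
        h1 (2 * k + 2 + e.toNat) (by simp; omega)]
      have : Conn k true Y := h2
      tauto
    · exact ⟨hX'.trans h1, h2⟩

theorem EndAt.congr {k : ℕ} (hk : 2 ≤ k) {X Y : Finset ℕ} (h : ∀ c, c ≤ 2 * k → (c ∈ Y ↔ c ∈ X))
    (hX : EndAt k X) : EndAt k Y := by
  obtain ⟨k, rfl⟩ := Nat.exists_eq_add_of_le' hk
  exact endAt_congr k h hX

theorem exch_below {m c d : ℕ} (X : Finset ℕ) (hc : m < c) (hd : m < d) :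
    ∀ a, a ≤ m → (a ∈ exch X c d ↔ a ∈ X) := by
  intro a ha
  have h1 : a ≠ c := by omega
  have h2 : a ≠ d := by omega
  simp [mem_exch, h1, h2]

theorem nb_top (k : ℕ) (hk : 2 ≤ k) (e : Bool) :
    (if e then v (k + 2) else vInf) = nb (k + 1) (2 * k + 2 + e.toNat) := by
  cases e
  · simp [nb, mul_add]
  · simp only [if_true, Bool.toNat_true]
    rw [nb, if_neg (by omega), if_pos (by omega)]

theorem nb_down (k : ℕ) (hk : 2 ≤ k) : v k = nb (k + 1) (2 * k + 1) := by
  rw [nb, if_neg (by omega), if_neg (by omega)]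
  rfl

theorem inc_down (k : ℕ) : Inc (k + 1) (2 * k + 1) := Or.inl (by omega)

theorem inc_top (k : ℕ) (hk : 2 ≤ k) (e : Bool) : Inc (k + 1) (2 * k + 2 + e.toNat) := by
  cases e
  · exact Or.inr (Or.inr ⟨rfl, by omega⟩)
  · exact Or.inr (Or.inl rfl)

/-- The first part of `gen (k + 1) true e` lists the trees in which `v (k + 1)` is a leaf attached to
`v k`, the second part those with the edge selected by `e`. -/
theorem genAll_succ {n k : ℕ} (hk : 2 ≤ k) (e : Bool) (hgen : GenAll n k false)
    (htop : GenTop n k e) : GenAll n (k + 1) e := by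
  rintro hkn X G ⟨hp, he⟩ hV hXG hfresh hctx
  obtain ⟨hp, hb, hs⟩ := (pathTo_succ hk).1 hp
  have hx : 2 * k + 2 + e.toNat ∉ X := by
    cases e
    · exact hs
    · exact he rfl
  have hcX := pathTo_conn hk hp
  rw [gen_succ_true hk]
  refine Lists.join (hgen (by simp; omega)) (htop hkn) (k := k + 1) (by omega) (by omega)
    (inc_down k) (inc_top k hk e) (nb_down k hk) (nb_top k hk e) ⟨hp, by simp⟩ hV hXG hfresh
    (fun _ h => absurd hb h) ⟨Agree.refl _ _, hcX⟩ ?_ ?_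
  · exact fun Y hY => (mem_allTrees_succ hk hb hx (fun _ => hs) (Agree.refl _ _)).2 (Or.inl hY)
  · rintro X₁ ⟨hA : Agree (2 * k) X X₁, hT₁ : Conn k true X₁⟩ hE₁ hV₁
    have hE₁ := (allEnd_false hk).1 hE₁
    have hb₁ : 2 * k + 1 ∈ X₁ := by rwa [hA _ (by omega)]
    have hx₁ : 2 * k + 2 + e.toNat ∉ X₁ := by rwa [hA _ (by omega)]
    have hs₁ : 2 * k + 2 ∉ X₁ := by rwa [hA _ (by omega)]
    have hTree₁ : Tree (k + 1) e X₁ := by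
      rw [tree_succ hk]
      tauto
    have hA₁ : Agree (2 * (k + 1) + e.toNat) X₁ (exch X₁ (2 * k + 1) (2 * k + 2 + e.toNat)) :=
      agree_exch _ (by omega) (by omega)
    have hE₂ : EndAt k (exch X₁ (2 * k + 1) (2 * k + 2 + e.toNat)) :=
      hE₁.congr hk (exch_below _ (by omega) (by omega))
    have hb₂ : 2 * k + 1 ∉ exch X₁ (2 * k + 1) (2 * k + 2 + e.toNat) :=
      not_mem_exch_old _ (by omega)
    have ht₂ : HasTop k e (exch X₁ (2 * k + 1) (2 * k + 2 + e.toNat)) := by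
      refine ⟨mem_exch_new _ _ _, fun h => ?_⟩
      subst h
      simpa [mem_exch] using hs₁
    generalize exch X₁ (2 * k + 1) (2 * k + 2 + e.toNat) = X₂ at *
    have hX₂ : X₂ ∈ TopTrees (k + 1) e X₂ :=
      (mem_topTrees hk ht₂).2 ⟨Agree.refl _ _, Or.inl ⟨hE₂.conn hk, hb₂⟩⟩
    have hA₂ := (hA.mono (by omega)).trans hA₁
    refine ⟨hb₁, hx₁, tree_valid (by omega) hkn hV₁ hTree₁ hX₂.2.1 hA₁, ⟨hE₂, hb₂, ht₂⟩, hX₂,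
      ?_, ?_, trivial, fun Y => mem_allTrees_succ hk hb hx (fun _ => hs) hA₂, ?_, fun _ _ h => h⟩
    · intro Y hY hAY
      have hTY := tree_same (by omega) (by omega) hV₁ hY hAY hTree₁
      have hxY : 2 * k + 2 + e.toNat ∉ Y := by rwa [hAY _ (by omega)]
      -- `Y` lacks the edge selected by `e`, as `X₁` does, so `v (k + 1)` is a leaf of `Y`, too.
      rw [tree_succ hk] at hTY
      refine ⟨?_, show Conn k true Y by tauto⟩
      exact agree_of_code ((hA.mono (by omega)).trans hAY)
        (iff_of_true (by tauto) hb)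
    · intro c d hc hd hcX hdX hlt hVe
      cases e
      · obtain ⟨rfl, rfl | rfl⟩ := rk_left_spoke (by omega) hc hd hlt
        · exact absurd hb₁ hdX
        -- The pivot of `v (k + 1)` from `v k` to `v (k + 2)`.
        · refine Or.inl (hctx rfl (by rwa [← hA _ (by omega)]) _ hVe ?_ (mem_exch_new _ _ _))
          exact (hA.mono (by omega)).trans (agree_exch _ (by omega) le_rfl)
      · rcases rk_left_right (by omega) hc hd hlt with rfl | rfl
        · exact absurd hcX hx₁
        · exact absurd hb₁ hdX
    · rintro Y ⟨h1 : Agree (2 * k) X Y, -⟩ ⟨-, -, h2⟩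
      exact hx ((h1 _ (by omega)).1 h2)

/-- The reversal of `genAll_succ`. -/
theorem revAll_succ {n k : ℕ} (hk : 2 ≤ k) (e : Bool) (htop : RevTop n k e)
    (hrev : RevAll n k false) : RevAll n (k + 1) e := by
  rintro hkn X G hE hV hXG hfresh hctx
  obtain ⟨hE', hb, ht⟩ := (allEnd_succ hk).1 hE
  have hcX := openEnd_conn hk hE'
  rw [revGen_succ_true hk]
  refine Lists.join (htop hkn) (hrev (by simp; omega)) (k := k + 1) (by omega) (by omega)
    (inc_top k hk e) (inc_down k) (nb_top k hk e) (nb_down k hk) hE hV hXG hfresh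
    trivial ((mem_topTrees hk ht).2 ⟨Agree.refl _ _, Or.inr ⟨hcX, hb⟩⟩) ?_ ?_
  · exact fun Y hY => ⟨hY.1, hY.2.1⟩
  · rintro X₁ hX₁ ⟨hE₁, hb₁, ht₁⟩ hV₁
    have hA₁ : Agree (2 * (k + 1) + e.toNat) X₁ (exch X₁ (2 * k + 2 + e.toNat) (2 * k + 1)) :=
      agree_exch _ (by omega) (by omega)
    have hE₂ : EndAt k (exch X₁ (2 * k + 2 + e.toNat) (2 * k + 1)) :=
      hE₁.congr hk (exch_below _ (by omega) (by omega))
    have hb₂ := mem_exch_new X₁ (2 * k + 2 + e.toNat) (2 * k + 1)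
    have hx₂ : 2 * k + 2 + e.toNat ∉ exch X₁ (2 * k + 2 + e.toNat) (2 * k + 1) :=
      not_mem_exch_old _ (by omega)
    have hs₂ : e = true → 2 * k + 2 ∉ exch X₁ (2 * k + 2 + e.toNat) (2 * k + 1) := by
      intro h
      have := ht₁.2 h
      simp [mem_exch, this]
    generalize exch X₁ (2 * k + 2 + e.toNat) (2 * k + 1) = X₂ at *
    have hA₂ := hX₁.1.trans hA₁
    have hc₂ := hE₂.conn hk
    have hTree₂ : Tree (k + 1) e X₂ := by
      rw [tree_succ hk]
      tauto
    have hV₂ := tree_valid (by omega) hkn hV₁ hX₁.2.1 hTree₂ hA₁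
    refine ⟨ht₁.1, hb₁, hV₂, (allEnd_false hk).2 hE₂, ⟨Agree.refl _ _, hc₂⟩, ?_, ?_, ?_, ?_, ?_, ?_⟩
    · intro Y hY hAY
      exact ⟨hX₁.1.trans (hAY.mono (by omega)),
        tree_same (by omega) (by omega) hV₁ hY hAY hX₁.2.1, (ht₁.congr hAY).1⟩
    · intro c d hc hd hcX hdX hlt hVe
      exfalso
      cases e
      · rcases rk_spoke_left (by omega) hc hd hlt with rfl | rfl
        · exact hb₁ hcX
        -- Removing the edge between `v (k + 1)` and `v (k + 2)` does not give a tree.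
        · have hd3 : 2 * (k + 1) + 1 ≠ d := fun h => hdX (h ▸ hcX)
          refine not_mem_exch_old X₁ hd3 (hctx rfl ?_ _ hVe ?_)
          · rwa [← hX₁.1 _ (by simp)]
          · refine (hX₁.1.mono (by simp)).trans (agree_exch _ le_rfl ?_)
            unfold Inc at hd
            omega
      · rcases rk_right_left (by omega) hc hd hlt with rfl | rfl
        · exact hb₁ hcX
        · exact hdX ht₁.1
    -- In `X₂`, `v (k + 1)` is a leaf, so that its edge to `v k` is in every tree.
    · intro _ _ Y hY hAY
      have hTY := tree_same (by omega) (by omega) hV₂ hY hAY hTree₂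
      have hxY : 2 * k + 2 + e.toNat ∉ Y := by rwa [hAY _ (by omega)]
      rw [tree_succ hk] at hTY
      tauto
    · intro Y
      rw [or_comm, ← mem_allTrees_succ hk hb₂ hx₂ hs₂ hA₂.symm]
      exact and_congr_left' ⟨fun h => hA₂.symm.trans h, fun h => hA₂.trans h⟩
    · rintro Y ⟨-, -, h2⟩ ⟨h1 : Agree (2 * k) X₂ Y, -⟩
      exact hx₂ ((h1 _ (by omega)).1 h2)
    · rintro Y ⟨hY : Agree (2 * k) X₂ Y, -⟩ ⟨hpY, -⟩
      refine ⟨(pathTo_succ hk).2 ⟨hpY, ?_, ?_⟩, fun h => ?_⟩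
      · rwa [hY _ (by omega)]
      · rw [hY _ (by omega)]
        cases e
        · exact hx₂
        · exact hs₂ rfl
      · subst h
        rwa [hY _ (by omega)]

/-! ### Small cases -/

theorem eq_of_conn_two {b : Bool} {X Y : Finset ℕ} (hX : Conn 2 b X) (hY : Conn 2 b Y)
    (h : Agree 4 X Y) : Y = X := by
  ext c
  by_cases hc : 4 < c
  · exact h c hc
  · by_cases h2 : c ≤ 2
    · exact iff_of_false (fun hc => absurd (hY.2.2 c hc) (by omega))
        (fun hc => absurd (hX.2.2 c hc) (by omega))
    · have : c = 3 ∨ c = 4 := by omega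
      rcases this with rfl | rfl
      · exact hY.1.trans hX.1.symm
      · exact iff_of_false hY.2.1 hX.2.1

/-- The empty procedure lists a class that consists of the first tree alone. -/
theorem Lists.nop {n : ℕ} {s f : Finset ℕ → Prop} {C : Finset ℕ → Set (Finset ℕ)}
    {ctx : Finset ℕ → Set (Finset ℕ) → Prop} (hsf : ∀ X, s X → f X)
    (hC : ∀ X, s X → ∀ Y, Y ∈ C X ↔ Y = X) : Lists n (fun S => S) s f C ctx := by
  intro X G hs hV hXG _ _
  refine ⟨X, (hC X hs X).2 rfl, hsf X hs, hV, (Does.id n X G).of_eq ?_⟩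
  refine (Set.union_eq_left.2 fun Y hY => ?_).symm
  rwa [(hC X hs Y).1 hY]

theorem Lists.imp {n : ℕ} {g : State → State} {s s' f f' : Finset ℕ → Prop}
    {C C' : Finset ℕ → Set (Finset ℕ)} {ctx ctx' : Finset ℕ → Set (Finset ℕ) → Prop}
    (h : Lists n g s f C ctx) (hs : ∀ X, s' X → s X) (hctx : ∀ X G, s' X → ctx' X G → ctx X G)
    (hC : ∀ X, s' X → C' X = C X) (hf : ∀ X, s' X → ∀ Y ∈ C X, f Y → f' Y) :
    Lists n g s' f' C' ctx' := by
  intro X G hX hV hXG hfresh hc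
  rw [hC X hX] at hfresh ⊢
  obtain ⟨X', h1, h2, h3⟩ := h X G (hs X hX) hV hXG hfresh (hctx X G hX hc)
  exact ⟨X', h1, hf X hX X' h1 h2, h3⟩

theorem mem_allTrees_two {b : Bool} {X Y : Finset ℕ} (hX : Conn 2 b X) :
    (Agree 4 X Y ∧ Conn 2 b Y) ↔ Y = X :=
  ⟨fun h => eq_of_conn_two hX h.2 h.1, by
    rintro rfl
    exact ⟨Agree.refl _ _, hX⟩⟩

theorem genAll_two_false (n : ℕ) : GenAll n 2 false := by
  intro _
  have : gen 2 true false = fun S => S := by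
    funext S
    simp [gen]
  rw [this]
  exact Lists.nop (fun _ h => h.1) (fun _ h _ => mem_allTrees_two h.1)

theorem revAll_two_false (n : ℕ) : RevAll n 2 false := by
  intro _
  have : revGen 2 true false = fun S => S := by
    funext S
    simp [revGen]
  rw [this]
  exact Lists.nop (fun _ h => ⟨h, by simp⟩) (fun _ h _ => mem_allTrees_two h)

theorem genOpen_two (n : ℕ) : GenOpen n 2 :=
  fun _ => Lists.nop (fun _ h => h) (fun _ h _ => mem_allTrees_two h)

theorem revOpen_two (n : ℕ) : RevOpen n 2 :=
  fun _ => Lists.nop (fun _ h => h) (fun _ h _ => mem_allTrees_two h)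

/-- The two trees on `v_2`, with the edge from `v_2` to `v_3` in the role of the spoke. -/
theorem mem_allTrees_two_true {X X' Y : Finset ℕ} (hX : Conn 2 true X) (h5 : 5 ∉ X)
    (hX' : Conn 2 false X') (h5' : 5 ∈ X') (h : Agree 5 X X') :
    (Agree 5 X Y ∧ Tree 2 true Y) ↔ Y = X ∨ Y = X' := by
  constructor
  · rintro ⟨hA, ⟨h1, h2, -⟩ | ⟨h1, h2⟩⟩
    · exact Or.inl (eq_of_conn_two hX h1 (hA.pred rfl (iff_of_false h2 h5)))
    · exact Or.inr (eq_of_conn_two hX' h1 ((h.symm.trans hA).pred rfl (iff_of_true h2 h5')))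
  · rintro (rfl | rfl)
    · exact ⟨Agree.refl _ _, Or.inl ⟨hX, h5, hX.2.1⟩⟩
    · exact ⟨h, Or.inr ⟨hX', h5'⟩⟩

theorem genAll_two_true (n : ℕ) : GenAll n 2 true := by
  rintro hn X G ⟨hp, h5⟩ hV hXG hfresh -
  have hn : 2 + 1 ≤ n := hn
  have h5 : 5 ∉ X := h5 rfl
  have hX₂ : Conn 2 false (exch X 3 5) := openStart_conn le_rfl (PathTo.exch (k := 2) le_rfl hp)
  have h5' := mem_exch_new X 3 5
  have hA : Agree 5 X (exch X 3 5) := agree_exch _ (by omega) le_rfl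
  have hmem := fun Y => mem_allTrees_two_true (Y := Y) hp h5 hX₂ h5' hA
  have hg : gen 2 true true = fun S => step (v 2) vInf (v 3) S := by
    funext S
    simp [gen]
  rw [hg]
  refine Lists.join (Lists.nop (s := fun X => Conn 2 true X) (C := fun X => {X})
      (ctx := fun _ _ => True) (fun _ h => h) (fun _ _ _ => Iff.rfl))
    (Lists.nop (s := fun X => Conn 2 false X ∧ 5 ∈ X) (C := fun X => {X})
      (ctx := fun _ _ => True) (fun _ h => h) (fun _ _ _ => Iff.rfl))
    (k := 2) (c := 3) (d := 5) le_rfl (by omega) (inc_left 2 le_rfl) (inc_right 2) rfl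
    (nb_right 2 le_rfl) hp hV hXG hfresh trivial rfl ?_ ?_
  · rintro Y rfl
    exact (hmem _).2 (Or.inl rfl)
  · rintro _ rfl - -
    refine ⟨hp.1.2 rfl, h5, ?_, ⟨hX₂, h5'⟩, rfl, ?_, ?_, trivial, hmem, ?_, ?_⟩
    · exact tree_valid le_rfl hn hV ((hmem _).2 (Or.inl rfl)).2 ((hmem _).2 (Or.inr rfl)).2 hA
    · intro Y hY hAY
      exact eq_of_conn_two hp (hV.same le_rfl (by omega) hY (hAY.mono (by omega)) hp)
        (hAY.mono (by omega))
    · intro c d hc hd hcX hdX hlt _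
      rcases rk_left_right le_rfl hc hd hlt with rfl | rfl
      · exact absurd hcX h5
      · exact absurd (hp.1.2 rfl) hdX
    · intro Y hY hY'
      have h1 : Y = _ := hY
      have h2 : Y = _ := hY'
      rw [← h2, h1] at h5'
      exact h5 h5'
    · exact fun _ _ h => h

theorem revAll_two_true (n : ℕ) : RevAll n 2 true := by
  rintro hn X G ⟨hp, h5⟩ hV hXG hfresh -
  have hn : 2 + 1 ≤ n := hn
  have hX₂ : Conn 2 true (exch X 5 3) := pathTo_conn le_rfl (OpenStart.exch (k := 2) le_rfl hp)
  have h5' : 5 ∉ exch X 5 3 := not_mem_exch_old X (by omega)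
  have h3 : 3 ∉ X := OpenStart.not_mem (k := 2) le_rfl hp
  have hA : Agree 5 X (exch X 5 3) := agree_exch _ le_rfl (by omega)
  have hmem : ∀ Y, (Agree 5 X Y ∧ Tree 2 true Y) ↔ Y = X ∨ Y = exch X 5 3 := by
    intro Y
    rw [or_comm, ← mem_allTrees_two_true hX₂ h5' hp h5 hA.symm]
    exact and_congr_left' ⟨fun h => hA.symm.trans h, fun h => hA.trans h⟩
  have hg : revGen 2 true true = fun S => step (v 2) (v 3) vInf S := by
    funext S
    simp [revGen]
  rw [hg]
  refine Lists.join (Lists.nop (s := fun X => Conn 2 false X) (C := fun X => {X})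
      (ctx := fun _ _ => True) (fun _ h => h) (fun _ _ _ => Iff.rfl))
    (Lists.nop (s := fun X => Conn 2 true X ∧ 5 ∉ X) (C := fun X => {X})
      (ctx := fun _ _ => True) (fun _ h => h) (fun _ _ _ => Iff.rfl))
    (k := 2) (c := 5) (d := 3) le_rfl (by omega) (inc_right 2) (inc_left 2 le_rfl)
    (nb_right 2 le_rfl) rfl hp hV hXG hfresh trivial rfl ?_ ?_
  · rintro Y rfl
    exact (hmem _).2 (Or.inl rfl)
  · rintro _ rfl - -
    refine ⟨h5, h3, ?_, ⟨hX₂, h5'⟩, rfl, ?_, ?_, trivial, hmem, ?_, ?_⟩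
    · exact tree_valid le_rfl hn hV ((hmem _).2 (Or.inl rfl)).2 ((hmem _).2 (Or.inr rfl)).2 hA
    · intro Y hY hAY
      exact eq_of_conn_two hp (hV.same le_rfl (by omega) hY (hAY.mono (by omega)) hp)
        (hAY.mono (by omega))
    · intro c d hc hd hcX hdX hlt _
      rcases rk_right_left le_rfl hc hd hlt with rfl | rfl
      · exact absurd hcX h3
      · exact absurd h5 hdX
    · intro Y hY hY'
      have h1 : Y = _ := hY
      have h2 : Y = _ := hY'
      rw [← h2, h1] at h5'
      exact h5' h5
    · exact fun _ _ h => ⟨h.1, fun _ => h.2⟩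

theorem mem_openTrees_three {X Y : Finset ℕ} (h : 6 ∉ X) :
    Y ∈ OpenTrees 3 X ↔ Y ∈ AllTrees 2 true X := by
  have h4 : Conn 2 true Y → 4 ∉ Y := fun h => h.2.1
  constructor
  · rintro ⟨h1, h2⟩
    rw [conn_false_succ le_rfl] at h2
    exact ⟨h1.pred (l := 5) rfl (iff_of_false h2.1 h), h2.2.resolve_right fun h => h4 h.1 h.2.1⟩
  · rintro ⟨h1, h2⟩
    refine ⟨h1.mono (by simp), (conn_false_succ le_rfl).2 ⟨?_, Or.inl h2⟩⟩
    rwa [h1 6 (by simp)]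

theorem genOpen_three (n : ℕ) : GenOpen n 3 := by
  intro hn
  have hg : openGen 3 = gen 2 true true := by
    funext S
    rfl
  rw [hg]
  refine (genAll_two_true n (by simpa using by omega)).imp (fun X h => ⟨h.1, fun _ => h.2.1⟩)
    (fun _ _ _ _ h => nomatch h) (fun X h => Set.ext fun Y => mem_openTrees_three h.2.2) ?_
  rintro X h Y ⟨hY, -⟩ ⟨h1, h2⟩
  exact ⟨h1, h2, by rw [hY 6 (by simp)]; exact h.2.2⟩

theorem revOpen_three (n : ℕ) : RevOpen n 3 := by
  intro hn
  have hg : openRev 3 = revGen 2 true true := by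
    funext S
    rfl
  rw [hg]
  refine (revAll_two_true n (by simpa using by omega)).imp (fun X h => ⟨h.1, h.2.1⟩)
    (fun _ _ _ _ h => nomatch h) (fun X h => Set.ext fun Y => mem_openTrees_three h.2.2) ?_
  rintro X h Y ⟨hY, -⟩ ⟨h1, h2⟩
  exact ⟨h1, h2 rfl, by rw [hY 6 (by simp)]; exact h.2.2⟩

/-! ### The open parts and the induction -/

/-- The open trees at `v (k + 1)`: the edge from `v k` to `v (k + 1)` takes the role of the spoke at
`v k`, or `v (k + 1)` is separated from `v k` and the spoke at `v k` is present. -/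
theorem mem_openTrees_succ {k : ℕ} (hk : 2 ≤ k) {X X₁ X₂ Y : Finset ℕ} (hc : 2 * k + 2 ∉ X)
    (h₁ : Agree (2 * k + 1) X X₁) (h₂ : Agree (2 * k + 1) X X₂) (hb : 2 * k + 1 ∉ X₂) :
    Y ∈ OpenTrees (k + 1) X ↔ Y ∈ AllTrees k true X₁ ∨ Y ∈ TopTrees k false X₂ := by
  constructor
  · rintro ⟨h1, h2⟩
    obtain ⟨h3, h4⟩ := (conn_false_succ hk).1 h2
    have hA : Agree (2 * k + 1) X Y := h1.pred rfl (iff_of_false h3 hc)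
    rcases h4 with h4 | ⟨h4, h5, h6⟩
    · exact Or.inl ⟨h₁.symm.trans hA, h4⟩
    · exact Or.inr ⟨(h₂.symm.trans hA).pred rfl (iff_of_false h6 hb), h4, h5⟩
  · rintro (⟨h1, h2⟩ | ⟨h1 : Agree (2 * k) X₂ Y, h2, h3⟩)
    · have hA : Agree (2 * k + 1) X Y := h₁.trans h1
      refine ⟨hA.mono (by omega), (conn_false_succ hk).2 ⟨?_, Or.inl h2⟩⟩
      rwa [hA _ (by omega)]
    · have hA : Agree (2 * k + 1) X Y := h₂.trans (h1.mono (by omega))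
      refine ⟨hA.mono (by omega), (conn_false_succ hk).2 ⟨?_, Or.inr ⟨h2, h3, ?_⟩⟩⟩
      · rwa [hA _ (by omega)]
      · rwa [h1 _ (by omega)]

theorem allTrees_disjoint_topTrees {k : ℕ} (hk : 2 ≤ k) {X X₂ Y : Finset ℕ}
    (h₁ : Y ∈ AllTrees k true X) (h₂ : Y ∈ TopTrees k false X₂) : False := by
  obtain ⟨-, ⟨-, -, h⟩ | ⟨h, -⟩⟩ := h₁
  · exact h h₂.2.2
  · exact Bool.noConfusion (conn_state_unique hk h h₂.2.1)

/-- The edge from `v (j + 1)` to `v (j + 2)`, in the role of the spoke at `v (j + 1)`, is available in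
the first part only; in the trees of the second part this spoke is present. -/
theorem genOpen_succ {n j : ℕ} (hj : 2 ≤ j) (hgen : GenAll n (j + 1) true)
    (hrev : RevTop n j false) : GenOpen n (j + 2) := by
  rintro hkn X G hs hV hXG hfresh -
  obtain ⟨hp, hb, hc⟩ := (openStart_succ (k := j + 1) (by omega)).1 hs
  have hopen : openGen (j + 2) = fun S => revGen (j + 1) false false
      (step (v (j + 1)) (v (j + 2)) vInf (gen (j + 1) true true S)) := by
    obtain ⟨j, rfl⟩ := Nat.exists_eq_add_of_le' hj
    rfl
  have hcX : Conn (j + 1 + 1) false X := openStart_conn (by omega) hs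
  have hTX : Tree (j + 1) true X := Or.inl
    ⟨pathTo_conn (by omega) hp, hb, ((pathTo_succ hj).1 hp).2.2⟩
  rw [hopen]
  refine Lists.join (hgen (show j + 1 + 1 ≤ n by omega)) (hrev (show j + 1 + 0 ≤ n by omega))
    (k := j + 1) (d := 2 * (j + 1)) (by omega) (by omega) (inc_right (j + 1)) (inc_top j hj false)
    (nb_right (j + 1) (by omega)) (nb_top j hj false)
    ⟨hp, fun _ => hb⟩ hV hXG hfresh (fun h => nomatch h) ⟨Agree.refl _ _, hTX⟩ ?_ ?_
  · rintro Y ⟨h1, h2⟩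
    exact ⟨h1.mono (show 2 * (j + 1) + 1 ≤ 2 * (j + 2) by omega), (conn_false_succ (by omega)).2
      ⟨by rwa [h1 _ (by simp)], Or.inl h2⟩⟩
  · rintro X₁ ⟨hA : Agree (2 * (j + 1) + 1) X X₁, hT₁⟩ hE₁ hV₁
    obtain ⟨hE₁, hl₁, hb₁ : 2 * (j + 1) + 1 ∈ X₁, ha₁⟩ := (allEnd_succ hj).1 hE₁
    have ha₁ : 2 * (j + 1) ∉ X₁ := ha₁ rfl
    have hc₁ : Conn (j + 1) false X₁ := by
      unfold Tree at hT₁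
      tauto
    have hA₁ : Agree (2 * (j + 1) + 1) X₁ (exch X₁ (2 * (j + 1) + 1) (2 * (j + 1))) :=
      agree_exch _ le_rfl (by omega)
    have hb₂ : 2 * (j + 1) + 1 ∉ exch X₁ (2 * (j + 1) + 1) (2 * (j + 1)) :=
      not_mem_exch_old _ (by omega)
    have ha₂ := mem_exch_new X₁ (2 * (j + 1) + 1) (2 * (j + 1))
    have hbel : ∀ c, c ≤ 2 * j + 1 →
        (c ∈ exch X₁ (2 * (j + 1) + 1) (2 * (j + 1)) ↔ c ∈ X₁) :=
      exch_below X₁ (by omega) (by omega)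
    generalize exch X₁ (2 * (j + 1) + 1) (2 * (j + 1)) = X₂ at *
    have hA₂ := hA.trans hA₁
    have hE₂ : AllEnd (j + 1) false X₂ := (allEnd_succ hj).2
      ⟨openEnd_congr hj (fun c hc => hbel c (by omega)) hE₁, (hbel _ le_rfl).2 hl₁, ha₂, by simp⟩
    have hc₂ : Conn (j + 1) true X₂ := EndAt.conn (by omega) ((allEnd_false (by omega)).1 hE₂)
    have hX₂ : X₂ ∈ TopTrees (j + 1) false X₂ := ⟨Agree.refl _ _, hc₂, ha₂⟩
    have hmem := fun Y => mem_openTrees_succ (k := j + 1) (Y := Y) (by omega) hc (Agree.refl _ X)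
      hA₂ hb₂
    have hX₂' := (hmem X₂).2 (Or.inr hX₂)
    refine ⟨hb₁, ha₁, hV.transfer (by omega) (by omega) hcX hX₂'.2 hX₂'.1, hE₂, hX₂, ?_, ?_,
      trivial, hmem, fun Y h1 h2 => allTrees_disjoint_topTrees (by omega) h1 h2, ?_⟩
    · intro Y hY hAY
      exact ⟨hA.trans (hAY.mono (by omega)), tree_same (by omega) (by omega) hV₁ hY hAY hT₁⟩
    · intro c d hc hd hcX hdX hlt hVe
      exfalso
      rcases rk_right_spoke (by omega) hc hd hlt with rfl | rfl | rfl
      · rcases hd with hd | rfl | ⟨rfl, -⟩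
        · obtain rfl : d = 2 * j + 1 := by omega
          exact hdX hl₁
        · exact hdX hb₁
        -- Below `v (j + 2)`, the vertex `v (j + 1)` is separated from `v_∞` and stays so: it has no
        -- spoke.
        · refine conn_false_spoke (by omega) ?_ (mem_exch_new X₁ (2 * (j + 1) - 1) (2 * (j + 1)))
          exact hV₁.same (by omega) (by omega) hVe (agree_exch _ (by omega) le_rfl) hc₁
      · exact hdX hl₁
      · exact hdX hb₁
    · rintro Y hY ⟨hEY, hlY, htY⟩
      have hAY := hY.1
      refine (openEnd_succ (by omega)).2 ⟨hEY, hlY, hY.2.2, ?_, ?_⟩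
      · rwa [hAY _ (by simp)]
      · rwa [hAY _ (by simp), hA₂ _ (by simp)]

/-- The reversal of `genOpen_succ`. -/
theorem revOpen_succ {n j : ℕ} (hj : 2 ≤ j) (hgen : GenTop n j false)
    (hrev : RevAll n (j + 1) true) : RevOpen n (j + 2) := by
  rintro hkn X G hs hV hXG hfresh -
  obtain ⟨hE, hl, ha, hb, hc⟩ := (openEnd_succ (k := j + 1) (by omega)).1 hs
  have hopen : openRev (j + 2) = fun S => revGen (j + 1) true true
      (step (v (j + 1)) vInf (v (j + 2)) (gen (j + 1) false false S)) := by
    obtain ⟨j, rfl⟩ := Nat.exists_eq_add_of_le' hj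
    rfl
  have hcX : Conn (j + 1 + 1) false X := openEnd_conn (by omega) hs
  have hcX' : Conn (j + 1) true X := by
    rw [conn_succ_true hj]
    have : Conn j true X := EndAt.conn hj hE
    have hl : 2 * j + 1 ∉ X := hl
    have ha : 2 * j + 2 ∈ X := ha
    tauto
  rw [hopen]
  refine Lists.join (hgen (show j + 1 + 0 ≤ n by omega)) (hrev (show j + 1 + 1 ≤ n by omega))
    (k := j + 1) (c := 2 * (j + 1)) (by omega) (by omega) (inc_top j hj false) (inc_right (j + 1))
    (nb_top j hj false) (nb_right (j + 1) (by omega))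
    ⟨hE, hl, ha, by simp⟩ hV hXG hfresh trivial ⟨Agree.refl _ _, hcX', ha⟩ ?_ ?_
  · intro Y hY
    exact (mem_openTrees_succ (by omega) hc (Agree.refl _ _) (Agree.refl _ _) hb).2 (Or.inr hY)
  · rintro X₁ ⟨hA : Agree (2 * (j + 1)) X X₁, hc₁ : Conn (j + 1) true X₁, ha₁⟩ hE₁ hV₁
    obtain ⟨hE₁, hl₁, -⟩ := (allEnd_succ hj).1 hE₁
    have hb₁ : 2 * (j + 1) + 1 ∉ X₁ := by rwa [hA _ (by simp)]
    have hA₁ : Agree (2 * (j + 1) + 1) X₁ (exch X₁ (2 * (j + 1)) (2 * (j + 1) + 1)) :=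
      agree_exch _ (by omega) le_rfl
    have ha₂ : 2 * (j + 1) ∉ exch X₁ (2 * (j + 1)) (2 * (j + 1) + 1) :=
      not_mem_exch_old _ (by omega)
    have hb₂ := mem_exch_new X₁ (2 * (j + 1)) (2 * (j + 1) + 1)
    have hbel : ∀ c, c ≤ 2 * j + 1 →
        (c ∈ exch X₁ (2 * (j + 1)) (2 * (j + 1) + 1) ↔ c ∈ X₁) :=
      exch_below X₁ (by omega) (by omega)
    generalize exch X₁ (2 * (j + 1)) (2 * (j + 1) + 1) = X₂ at *
    have hA₂ := (hA.mono (Nat.le_succ _)).trans hA₁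
    have hE₂' := openEnd_congr hj (fun c hc => hbel c (by omega)) hE₁
    have hl₂ := (hbel _ le_rfl).2 hl₁
    have hE₂ : AllEnd (j + 1) true X₂ := (allEnd_succ hj).2 ⟨hE₂', hl₂, hb₂, fun _ => ha₂⟩
    have hc₂ : Conn (j + 1) false X₂ := by
      rw [conn_succ_false hj]
      exact Or.inr ⟨openEnd_conn hj hE₂', hl₂, ha₂⟩
    have hX₂ : X₂ ∈ AllTrees (j + 1) true X₂ := ⟨Agree.refl _ _, Or.inr ⟨hc₂, hb₂⟩⟩
    have hmem : ∀ Y, Y ∈ OpenTrees (j + 1 + 1) X ↔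
        Y ∈ TopTrees (j + 1) false X ∨ Y ∈ AllTrees (j + 1) true X₂ := by
      intro Y
      rw [or_comm]
      exact mem_openTrees_succ (by omega) hc hA₂ (Agree.refl _ X) hb
    have hX₂' := (hmem X₂).2 (Or.inr hX₂)
    have hX₁' := (hmem X₁).2 (Or.inl ⟨hA, hc₁, ha₁⟩)
    refine ⟨ha₁, hb₁, hV.transfer (by omega) (by omega) hcX hX₂'.2 hX₂'.1, hE₂, hX₂, ?_, ?_,
      (fun h => nomatch h), hmem, fun Y h1 h2 => allTrees_disjoint_topTrees (by omega) h2 h1, ?_⟩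
    · intro Y hY hAY
      refine ⟨hA.trans (hAY.mono (by simp)),
        tree_same (e := false) (by omega) (by omega) hV₁ hY hAY hc₁, ?_⟩
      rwa [hAY _ (by simp)]
    · intro c d hc hd hcX hdX hlt hVe
      exfalso
      rcases rk_spoke_right (by omega) hc hd hlt with rfl | rfl | rfl
      · rcases hd with hd | rfl | ⟨rfl, -⟩
        · obtain rfl : d = 2 * j + 1 := by omega
          exact hdX hl₁
        -- With its spoke and the edge to `v (j + 2)`, the vertex `v (j + 1)` would join `v (j + 2)` to
        -- `v_∞`.
        · have hAe : Agree (2 * (j + 1 + 1)) X₁ (exch X₁ (2 * (j + 1) - 1) (2 * (j + 1) + 1)) :=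
            agree_exch _ (by omega) (by omega)
          have hce := hV₁.same (by omega) (by omega) hVe hAe hX₁'.2
          have hbe := mem_exch_new X₁ (2 * (j + 1) - 1) (2 * (j + 1) + 1)
          have hae : 2 * (j + 1) ∈ exch X₁ (2 * (j + 1) - 1) (2 * (j + 1) + 1) :=
            mem_exch.2 (Or.inr ⟨by omega, ha₁⟩)
          rw [conn_succ_false (by omega)] at hce
          exact conn_false_spoke (k := j + 1) (by omega) (by tauto) hae
        · exact hdX ha₁
      · exact hb₁ hcX
      · exact hdX hl₁
    · rintro Y hY ⟨hpY, hbY⟩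
      have hAY := hY.1
      refine (openStart_succ (by omega)).2 ⟨hpY, hbY rfl, ?_⟩
      rwa [hAY _ (by simp), hA₂ _ (by simp)]

/-- All specifications, by simultaneous induction. As `GenTop n k` uses `GenOpen n k`, which in
turn uses specifications below `k` only, `GenOpen` and `RevOpen` are carried one step ahead. -/
theorem specs (n k : ℕ) (hk : 2 ≤ k) :
    (∀ e, GenAll n k e ∧ RevAll n k e ∧ GenTop n k e ∧ RevTop n k e) ∧
      GenOpen n k ∧ RevOpen n k ∧ GenOpen n (k + 1) ∧ RevOpen n (k + 1) := by
  induction k, hk using Nat.le_induction with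
  | base =>
    refine ⟨fun e => ⟨?_, ?_, genTop le_rfl e (revAll_two_false n) (genOpen_two n),
      revTop le_rfl e (revOpen_two n) (genAll_two_false n)⟩,
      genOpen_two n, revOpen_two n, genOpen_three n, revOpen_three n⟩
    · cases e
      exacts [genAll_two_false n, genAll_two_true n]
    · cases e
      exacts [revAll_two_false n, revAll_two_true n]
  | succ k hk ih =>
    obtain ⟨h, -, -, ho, ho'⟩ := ih
    have h1 := fun e => genAll_succ hk e (h false).1 (h e).2.2.1
    have h2 := fun e => revAll_succ hk e (h e).2.2.2 (h false).2.1
    exact ⟨fun e => ⟨h1 e, h2 e, genTop (by omega) e (h2 false) ho,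
      revTop (by omega) e ho' (h1 false)⟩, ho, ho',
      genOpen_succ hk (h1 true) (h false).2.2.2, revOpen_succ hk (h false).2.2.1 (h2 true)⟩

/-! ### The initial path -/

/-- The codes of the path `v_∞, v_2, …, v_n`. -/
def pathCodes (n : ℕ) : Finset ℕ := (Finset.Ico 1 n).image fun i => 2 * i + 1

theorem mem_pathCodes {n c : ℕ} : c ∈ pathCodes n ↔ c % 2 = 1 ∧ 3 ≤ c ∧ c < 2 * n := by
  simp only [pathCodes, Finset.mem_image, Finset.mem_Ico]
  constructor
  · rintro ⟨i, hi, rfl⟩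
    omega
  · exact fun h => ⟨c / 2, by omega, by omega⟩

theorem path_eq_enc {n : ℕ} (hn : 2 ≤ n) : path n = enc (pathCodes n) := by
  have hedge : ∀ i, 2 ≤ i → edge (2 * i + 1) = s(v i, v (i + 1)) := fun i hi => by
    rw [edge_eq hi (Or.inr (Or.inl rfl)), nb, if_neg (by omega), if_pos rfl]
  ext e
  simp only [path, Finset.mem_insert, Finset.mem_image, Finset.mem_Ico, mem_enc, mem_pathCodes]
  constructor
  · rintro (rfl | ⟨i, hi, rfl⟩)
    · exact ⟨3, by omega, Sym2.eq_swap⟩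
    · exact ⟨2 * i + 1, by omega, hedge i hi.1⟩
  · rintro ⟨c, hc, rfl⟩
    by_cases h3 : c = 3
    · subst h3
      exact Or.inl Sym2.eq_swap
    · refine Or.inr ⟨c / 2, by omega, ?_⟩
      rw [← hedge _ (by omega)]
      congr 1
      omega

theorem pathTo_pathCodes {n k : ℕ} (hk : 2 ≤ k) (hkn : k ≤ n) : PathTo k (pathCodes n) := by
  induction k, hk using Nat.le_induction with
  | base =>
    refine ⟨?_, ?_, fun c hc => ?_⟩
    · exact iff_of_true (mem_pathCodes.2 (by omega)) rfl
    · rw [mem_pathCodes]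
      omega
    · rw [mem_pathCodes] at hc
      omega
  | succ k hk ih =>
    rw [pathTo_succ hk, mem_pathCodes, mem_pathCodes]
    exact ⟨ih (by omega), by omega, by omega⟩

theorem valid_pathCodes {n : ℕ} (hn : 2 ≤ n) : Valid n (pathCodes n) := by
  refine ⟨pathTo_conn hn (pathTo_pathCodes hn le_rfl), fun c hc => ?_⟩
  rw [mem_pathCodes] at hc
  omega

/-! ### Greedy steps and the greedy listing -/

theorem findSome_eq_of_pairwise {β : Type*} {l : List Label} (hl : l.Pairwise (· < ·))
    {f : Label → Option β} {u : Label} {b : β} (hu : u ∈ l) (hf : f u = some b)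
    (hlt : ∀ u' ∈ l, u' < u → f u' = none) : l.findSome? f = some b := by
  induction l with
  | nil => simp at hu
  | cons a l ih =>
    rw [List.pairwise_cons] at hl
    rcases List.mem_cons.1 hu with rfl | hu
    · rw [List.findSome?_cons, hf]
    · rw [List.findSome?_cons, hlt a (List.mem_cons_self ..) (hl.1 u hu)]
      exact ih hl.2 hu fun u' hu' h => hlt u' (List.mem_cons_of_mem _ hu') h

theorem find_eq_of_pairwise {l : List Label} (hl : l.Pairwise (· < ·))
    {p : Label → Bool} {u : Label} (hu : u ∈ l) (hp : p u = true)
    (hlt : ∀ u' ∈ l, u' < u → p u' = false) : l.find? p = some u := by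
  induction l with
  | nil => simp at hu
  | cons a l ih =>
    rw [List.pairwise_cons] at hl
    rcases List.mem_cons.1 hu with rfl | hu
    · rw [List.find?_cons, hp]
    · rw [List.find?_cons, hlt a (List.mem_cons_self ..) (hl.1 u hu)]
      exact ih hl.2 hu fun u' hu' h => hlt u' (List.mem_cons_of_mem _ hu') h

theorem pairwise_vertexList (n : ℕ) : (vertexList n).Pairwise (· < ·) := by
  rw [vertexList, List.pairwise_append]
  refine ⟨?_, by simp, ?_⟩
  · rw [List.pairwise_map]
    exact (List.pairwise_lt_range' ..).imp fun h => v_lt.2 h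
  · intro a ha b hb
    simp only [List.mem_map, List.mem_singleton] at ha hb
    obtain ⟨i, -, rfl⟩ := ha
    rw [hb]
    exact v_lt_vInf i

open Classical in
theorem GreedyStep.nextTree_eq {n : ℕ} {S S' : State} (h : GreedyStep n S S') {G : List EdgeSet}
    (hG : ∀ T, T ∈ G ↔ T ∈ S.printed) : nextTree n G S.tree = some S'.tree := by
  obtain ⟨u, hu, x, hx, y, hy, hux, huy, rfl, htree, hnew, hmin⟩ := h
  have hl := pairwise_vertexList n
  have hp : ∀ T, decide (IsSpanningTree n T ∧ T ∉ G) = false ↔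
      (IsSpanningTree n T → T ∈ S.printed) := by
    intro T
    rw [decide_eq_false_iff_not, hG]
    tauto
  rw [nextTree, candidates, List.find?_flatMap]
  refine findSome_eq_of_pairwise hl hu ?_ ?_
  · rw [List.find?_flatMap]
    refine findSome_eq_of_pairwise (hl.filter _) (List.mem_filter.2 ⟨hx, by simpa using hux⟩) ?_ ?_
    · rw [List.find?_map, find_eq_of_pairwise (hl.filter _) (u := y)
        (List.mem_filter.2 ⟨hy, by simpa using huy⟩)]
      · rfl
      · simp only [Function.comp_apply, decide_eq_true_eq, hG]
        exact ⟨htree, hnew⟩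
      · intro y' hy' hlt
        rw [List.mem_filter] at hy'
        exact (hp _).2 (hmin u hu x hx y' hy'.1 (Or.inr ⟨rfl, Or.inr ⟨rfl, hlt⟩⟩) hux
          (by simpa using hy'.2))
    · intro x' hx' hlt
      rw [List.mem_filter] at hx'
      rw [List.find?_eq_none]
      intro T hT
      obtain ⟨y', hy', rfl⟩ := List.mem_map.1 hT
      rw [List.mem_filter] at hy'
      rw [Bool.not_eq_true]
      exact (hp _).2 (hmin u hu x' hx'.1 y' hy'.1 (Or.inr ⟨rfl, Or.inl hlt⟩)
        (by simpa using hx'.2) (by simpa using hy'.2))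
  · intro u' hu' hlt
    rw [List.find?_eq_none]
    intro T hT
    obtain ⟨x', hx', hT⟩ := List.mem_flatMap.1 hT
    obtain ⟨y', hy', rfl⟩ := List.mem_map.1 hT
    rw [List.mem_filter] at hx' hy'
    rw [Bool.not_eq_true]
    exact (hp _).2 (hmin u' hu' x' hx'.1 y' hy'.1 (Or.inl hlt)
      (by simpa using hx'.2) (by simpa using hy'.2))

open Classical in
theorem nextTree_eq_none {n : ℕ} {G : List EdgeSet} {T : EdgeSet}
    (h : ∀ T, IsSpanningTree n T → T ∈ G) : nextTree n G T = none := by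
  rw [nextTree, List.find?_eq_none]
  intro T' _
  rw [decide_eq_true_eq]
  exact fun h' => h'.2 (h T' h'.1)

theorem greedyFrom_of_none {n : ℕ} {G : List EdgeSet} {T : EdgeSet} (h : nextTree n G T = none) :
    greedyFrom n G T = [] := by
  rw [greedyFrom]
  split
  · rfl
  · simp_all

theorem greedyFrom_of_some {n : ℕ} {G : List EdgeSet} {T T' : EdgeSet}
    (h : nextTree n G T = some T') : greedyFrom n G T = T' :: greedyFrom n (T' :: G) T' := by
  rw [greedyFrom]
  split
  · simp_all
  · simp_all

/-- Greedy steps that exhaust the spanning trees print the greedy listing. -/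
theorem printed_eq_greedyFrom {n : ℕ} {S S' : State}
    (h : Relation.ReflTransGen (GreedyStep n) S S')
    (hS' : ∀ T, IsSpanningTree n T → T ∈ S'.printed) (G : List EdgeSet)
    (hG : ∀ T, T ∈ G ↔ T ∈ S.printed) :
    S'.printed = S.printed ++ greedyFrom n G S.tree := by
  induction h using Relation.ReflTransGen.head_induction_on generalizing G with
  | refl =>
    rw [greedyFrom_of_none (nextTree_eq_none fun T hT => (hG T).2 (hS' T hT)), List.append_nil]
  | head hstep _ ih =>
    rename_i S S₁ _
    have hnext := hstep.nextTree_eq hG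
    obtain ⟨u, -, x, -, y, -, -, -, rfl, -⟩ := hstep
    rw [greedyFrom_of_some hnext, ih ((step u x y S).tree :: G)]
    · simp [step]
    · intro T
      simp only [List.mem_cons, hG, step, List.mem_append, List.not_mem_nil, or_false]
      tauto

/-- The listing printed so far is a pivot Gray code for the trees in it. -/
def IsPartialGrayCode (n : ℕ) (S : State) : Prop :=
  S.printed.Nodup ∧ (∀ T ∈ S.printed, IsSpanningTree n T) ∧ S.printed.IsChain IsPivot ∧
    S.printed.getLast? = some S.tree

theorem IsPartialGrayCode.of_steps {n : ℕ} {S S' : State} (hS : IsPartialGrayCode n S)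
    (h : Relation.ReflTransGen (GreedyStep n) S S') : IsPartialGrayCode n S' := by
  induction h with
  | refl => exact hS
  | tail _ hstep ih =>
    obtain ⟨h1, h2, h3, h4⟩ := ih
    obtain ⟨u, -, x, -, y, -, hux, huy, rfl, htree, hnew, -⟩ := hstep
    refine ⟨?_, ?_, ?_, by simp [step]⟩
    · simp only [step]
      rw [List.nodup_append]
      refine ⟨h1, by simp, fun a ha b hb hab => ?_⟩
      rw [List.mem_singleton] at hb
      exact hnew (hb ▸ hab ▸ ha)
    · intro T hT
      simp only [step, List.mem_append, List.mem_singleton] at hT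
      rcases hT with hT | rfl
      · exact h2 T hT
      · exact htree
    · simp only [step]
      rw [List.isChain_append]
      refine ⟨h3, by simp, ?_⟩
      intro a ha b hb
      rw [h4, Option.mem_some_iff] at ha
      rw [List.head?_cons, Option.mem_some_iff] at hb
      subst ha hb
      exact ⟨u, x, y, hux, huy, rfl⟩

theorem listing_eq_greedy_and_isPivotGrayCode (n : ℕ) (hn : 2 ≤ n) :
    listing n = greedy n (path n) ∧
      IsPivotGrayCode n (listing n) := by
  have hV := valid_pathCodes hn
  have hpath := path_eq_enc hn
  have hlists := ((specs n n hn).1 false).1 (by simp)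
  obtain ⟨X', -, -, -, hdo⟩ := hlists (pathCodes n) {pathCodes n}
    ⟨pathTo_pathCodes hn le_rfl, by simp⟩ hV rfl (fun Y _ h => h)
    (fun _ _ Y hY _ h => absurd (hY.2 _ h) (by omega))
  obtain ⟨henc, hsteps⟩ := hdo ⟨path n, [path n]⟩
    ⟨hpath, fun Y => by
      simp only [hpath, List.mem_singleton, enc_injective.eq_iff, Set.mem_singleton_iff]⟩
  have hall : ∀ T, IsSpanningTree n T → T ∈ listing n := by
    intro T hT
    obtain ⟨Y, rfl, hY⟩ := (isSpanningTree_iff hn).1 hT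
    refine (henc.printed Y).2 (Or.inr ⟨fun c hc => ?_, hY.1⟩)
    simp only [Bool.toNat_false, add_zero] at hc
    exact iff_of_false (fun h => absurd (hY.2 c h) (by omega))
      (fun h => absurd (hV.2 c h) (by omega))
  have hgray : IsPartialGrayCode n (gen n true false ⟨path n, [path n]⟩) := by
    refine IsPartialGrayCode.of_steps ⟨by simp, ?_, by simp, rfl⟩ hsteps
    intro T hT
    rw [List.mem_singleton] at hT
    rw [hT, hpath, isSpanningTree_enc hn]
    exact hV
  refine ⟨?_, hgray.1, fun T => ⟨hgray.2.1 T, hall T⟩, hgray.2.2.1⟩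
  exact printed_eq_greedyFrom hsteps hall [path n] (fun _ => Iff.rfl)

end FanTrees

theorem mainTheorem1 (n : ℕ) (hn : 2 ≤ n) :
    FanTrees.listing n = FanTrees.greedy n (FanTrees.path n) ∧
      FanTrees.IsPivotGrayCode n (FanTrees.listing n) :=
  FanTrees.listing_eq_greedy_and_isPivotGrayCode n hn
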